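/- An involution on $n$ letters is a permutation $\pi\in S_n$ with $\pi=\pi^{-1}$. An occurrence of the pattern $3412$ in $\pi$ is a sequence of positions $1\le i_1<i_2<i_3<i_4\le n$ such that $(\pi(i_1),\pi(i_2),\pi(i_3),\pi(i_4))$ is order-isomorphic to $3412$, that is, $\pi(i_3)<\pi(i_4)<\pi(i_1)<\pi(i_2)$. For $r\ge 0$ let $$\mathcal I_r(x)=\sum_{n\ge 0}\#\{\pi\in S_n : \pi=\pi^{-1},\ \pi \text{ has exactly } r \text{ occurrences of } 3412\}\,x^n\in\mathbb Q[[x]],$$ and let $\sqrt{1-2x-3x^2}\in\mathbb Q[[x]]$ be the power series with constant term $1$ whose square is $1-2x-3x^2$. Then for every $r\ge 0$ the series $\mathcal I_r(x)$ is a rational function of $x$ and $\sqrt{1-2x-3x^2}$: there are polynomials $P,Q\in\mathbb Q[u,v]$ with $Q\bigl(x,\sqrt{1-2x-3x^2}\bigr)\neq 0$ and $$\mathcal I_r(x)=\frac{P\bigl(x,\sqrt{1-2x-3x^2}\bigr)}{Q\bigl(x,\sqrt{1-2x-3x^2}\bigr)}$$ in the field of formal Laurent series over $\mathbb Q$. 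-/

import Mathlib

open scoped PowerSeries LaurentSeries

namespace PatternInvolutions

/-- The occurrences of the pattern `τ ∈ S_m` in `π ∈ S_n`: the increasing sequences of positions
`f 0 < f 1 < ⋯ < f (m - 1)` for which `(π (f 0), …, π (f (m - 1)))` is order-isomorphic
to `τ`. -/
def occurrences {m n : ℕ} (τ : Equiv.Perm (Fin m)) (π : Equiv.Perm (Fin n)) :
    Finset (Fin m → Fin n) :=
  Finset.univ.filter fun f =>
    (∀ a b, a < b → f a < f b) ∧ ∀ a b, π (f a) < π (f b) ↔ τ a < τ b

/-- The permutation `3412`, written on the letters `0, 1, 2, 3`. -/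
def pattern3412 : Equiv.Perm (Fin 4) where
  toFun := ![2, 3, 0, 1]
  invFun := ![2, 3, 0, 1]
  left_inv := by decide
  right_inv := by decide

/-- The involutions (`π = π⁻¹`) on `n` letters containing `3412` exactly `r` times. -/
def involutions3412 (r n : ℕ) : Finset (Equiv.Perm (Fin n)) :=
  Finset.univ.filter fun π => π = π⁻¹ ∧ (occurrences pattern3412 π).card = r

/-- The generating function `I_r(x) = ∑ₙ #{involutions on n letters with exactly r occurrences} xⁿ`,
as a formal power series. -/
def genFun (r : ℕ) : ℚ⟦X⟧ :=
  PowerSeries.mk fun n => ((involutions3412 r n).card : ℚ)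

/-- The power series `√(1 - 2x - 3x²)`, the binomial series `(1 + u)^(1/2)` at `u = -2x - 3x²`.
The lemmas below show that it is the only square root of
`1 - 2x - 3x²` with constant term `1`. -/
noncomputable def sqrtSeries : ℚ⟦X⟧ :=
  (PowerSeries.binomialSeries ℚ (1 / 2 : ℚ)).subst
    (-2 * PowerSeries.X - 3 * PowerSeries.X ^ 2 : ℚ⟦X⟧)

theorem hasSubst_aux :
    PowerSeries.HasSubst (-2 * PowerSeries.X - 3 * PowerSeries.X ^ 2 : ℚ⟦X⟧) :=
  PowerSeries.HasSubst.of_constantCoeff_zero' (by simp)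

theorem sqrtSeries_sq :
    sqrtSeries ^ 2 = 1 - 2 * PowerSeries.X - 3 * PowerSeries.X ^ 2 := by
  have h : (PowerSeries.binomialSeries ℚ (1 / 2 : ℚ)) ^ 2 = 1 + PowerSeries.X := by
    rw [sq, ← PowerSeries.binomialSeries_add]
    have := PowerSeries.binomialSeries_nat (R := ℚ) (A := ℚ) 1
    norm_num at this ⊢
    exact this
  rw [sqrtSeries, ← PowerSeries.subst_pow hasSubst_aux, h,
    PowerSeries.subst_add hasSubst_aux, PowerSeries.subst_X hasSubst_aux]
  have : PowerSeries.subst (-2 * PowerSeries.X - 3 * PowerSeries.X ^ 2 : ℚ⟦X⟧) (1 : ℚ⟦X⟧)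
      = (1 : ℚ⟦X⟧) := by
    rw [← PowerSeries.coe_substAlgHom hasSubst_aux, map_one]
  rw [this]
  ring

theorem constantCoeff_sqrtSeries : PowerSeries.constantCoeff sqrtSeries = 1 := by
  have hc : PowerSeries.constantCoeff (-2 * PowerSeries.X - 3 * PowerSeries.X ^ 2 : ℚ⟦X⟧) = 0 := by
    simp
  have h0 := PowerSeries.constantCoeff_subst_eq_zero hc
    (PowerSeries.binomialSeries ℚ (1 / 2 : ℚ) - 1) (by simp)
  have h1 : PowerSeries.subst (-2 * PowerSeries.X - 3 * PowerSeries.X ^ 2 : ℚ⟦X⟧)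
      (PowerSeries.binomialSeries ℚ (1 / 2 : ℚ) - 1) = sqrtSeries - 1 := by
    rw [sqrtSeries, ← PowerSeries.coe_substAlgHom hasSubst_aux, map_sub, map_one]
  rw [h1] at h0
  have h2 : PowerSeries.constantCoeff (sqrtSeries - 1) = 0 := h0
  rw [map_sub, map_one] at h2
  linarith

theorem sqrtSeries_unique (S : ℚ⟦X⟧) (h0 : PowerSeries.constantCoeff S = 1)
    (h : S ^ 2 = 1 - 2 * PowerSeries.X - 3 * PowerSeries.X ^ 2) : S = sqrtSeries := by
  rw [← sqrtSeries_sq] at h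
  rcases sq_eq_sq_iff_eq_or_eq_neg.mp h with h | h
  · exact h
  · have := congrArg PowerSeries.constantCoeff h
    rw [map_neg, h0, constantCoeff_sqrtSeries] at this
    norm_num at this

end PatternInvolutions

/-! Draw an involution as a system of arcs and fixed points. The component of the first letter is
the smallest invariant set of letters that contains it and separates no arc outside it. Every arc
outside the component then lies in one of the gaps that follow its letters, so a nonempty involution
is uniquely a component `C` with `k` letters and one arbitrary involution in each of its `k` gaps
(`assemble_injective`, `exists_assemble`).

Two crossing arcs form an occurrence of 3412. In a component with at least three letters each letter
lies on such a crossing, hence `k` is at most four times the number of occurrences. With at most `r`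
occurrences only finitely many components are possible; those that need no occurrence are the single
fixed point and the single arc.

To follow occurrences that spread over several gaps, count the placements of every subset `B` of the
letters of the pattern. The counts for the assembled word are polynomials, with natural coefficients
that depend only on `C`, in the counts for the blocks (`count_assemble`). Capping at `r + 1`
respects sums and products in `ℕ`, so the vector `v` of capped counts of the word depends only on
`C` and on the capped vectors of the blocks. The series `F_v` of the finitely many classes with at
most `r` occurrences therefore satisfy a finite polynomial system.

Counts in a block never exceed those of the word, so the system is triangular and can be solved by
induction on `v`. The series `F_v` itself occurs on the right only for `k ≤ 2`. It occurs
quadratically only if both blocks of an arc have the capped vector `v`; this forces zero occurrences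
and all other counts at the cap, so `v = topStat r`. For every other `v` the equation is affine in
`F_v` and solvable over the field (`isAffineIn_product`). The series of `topStat r` is obtained by
subtraction: all classes without occurrences add up to the Motzkin series `M = 1 + xM + x²M²`, which
is where the square root enters. -/

namespace PatternInvolutions

/-! ### Partial occurrences of the pattern, and their distribution over blocks -/

/-- The partial occurrences of `3412` in the word of `f`: placements, inside `S`, of the letters of
the pattern that lie in `B`. -/
def partialOccurrences {α : Type*} [LT α] (f : α → α) (S : Set α) (B : Finset (Fin 4)) :
    Set (Fin 4 → Option α) :=
  {g | (∀ b, (g b).isSome ↔ b ∈ B) ∧ (∀ b x, g b = some x → x ∈ S) ∧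
    ∀ a b x y, g a = some x → g b = some y →
      (x < y ↔ a < b) ∧ (f x < f y ↔ pattern3412 a < pattern3412 b)}

/-- The number of partial occurrences of `3412`. -/
noncomputable def occCount {α : Type*} [LT α] (f : α → α) (S : Set α) (B : Finset (Fin 4)) : ℕ :=
  (partialOccurrences f S B).ncard

/-- Only comparisons between values enter, so `f` need not preserve the range of `e`. This covers a
single letter of the component, whose image may be another letter. -/
theorem occCount_range {α β : Type*} [LT α] [LT β] {f : α → α} {f' : β → β} (e : β → α)
    (he : Function.Injective e) (hlt : ∀ x y, e x < e y ↔ x < y)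
    (hf : ∀ x y, f (e x) < f (e y) ↔ f' x < f' y) (B : Finset (Fin 4)) :
    occCount f (Set.range e) B = occCount f' Set.univ B := by
  have : partialOccurrences f (Set.range e) B
      = (fun g b => (g b).map e) '' partialOccurrences f' Set.univ B := by
    ext g
    constructor
    · rintro ⟨h1, h2, h3⟩
      have h4 : ∀ b, ∃ x : Option β, x.map e = g b := by
        intro b
        rcases hb : g b with _ | x
        · exact ⟨none, rfl⟩
        · obtain ⟨y, rfl⟩ := h2 b x hb
          exact ⟨some y, rfl⟩
      choose g' hg' using h4
      refine ⟨g', ⟨fun b => ?_, fun _ _ _ => trivial, fun a b x y hx hy => ?_⟩, funext hg'⟩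
      · rw [← h1 b, ← hg' b, Option.isSome_map]
      · have := h3 a b (e x) (e y) (by rw [← hg', hx]; rfl) (by rw [← hg', hy]; rfl)
        rwa [hlt, hf] at this
    · rintro ⟨g', ⟨h1, -, h3⟩, rfl⟩
      refine ⟨fun b => ?_, fun b x hx => ?_, fun a b x' y' hx' hy' => ?_⟩
      · rw [← h1 b, Option.isSome_map]
      · obtain ⟨y, -, rfl⟩ := Option.map_eq_some_iff.1 hx
        exact ⟨y, rfl⟩
      · obtain ⟨x, hx, rfl⟩ := Option.map_eq_some_iff.1 hx'
        obtain ⟨y, hy, rfl⟩ := Option.map_eq_some_iff.1 hy'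
        rw [hlt, hf]
        exact h3 a b x y hx hy
  rw [occCount, occCount, this, Set.ncard_image_of_injective]
  intro g g' h
  funext b
  exact Option.map_injective he (congrFun h b)

theorem occCount_congr_equiv {α β : Type*} [LT α] [LT β] {f : α → α} {f' : β → β} (e : β ≃ α)
    (hlt : ∀ x y, e x < e y ↔ x < y) (hf : ∀ x, f (e x) = e (f' x)) (B : Finset (Fin 4)) :
    occCount f Set.univ B = occCount f' Set.univ B := by
  rw [← e.surjective.range_eq, occCount_range (f' := f') e e.injective hlt]
  intro x y
  rw [hf, hf, hlt]

theorem occCount_mono {α : Type*} [Finite α] [LT α] (f : α → α) {S S' : Set α} (h : S ⊆ S')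
    (B : Finset (Fin 4)) : occCount f S B ≤ occCount f S' B :=
  Set.ncard_le_ncard (fun _ hg => ⟨hg.1, fun b x hx => h (hg.2.1 b x hx), hg.2.2⟩)
    (Set.toFinite _)

theorem occCount_add_le {α : Type*} [Finite α] [LT α] (f : α → α) {S S' : Set α}
    (h : Disjoint S S') {B : Finset (Fin 4)} (hB : B.Nonempty) :
    occCount f S B + occCount f S' B ≤ occCount f Set.univ B := by
  rw [occCount, occCount, ← Set.ncard_union_eq _ (Set.toFinite _) (Set.toFinite _)]
  · refine Set.ncard_le_ncard (Set.union_subset ?_ ?_) (Set.toFinite _) <;>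
      exact fun g hg => ⟨hg.1, fun _ _ _ => trivial, hg.2.2⟩
  · rw [Set.disjoint_left]
    intro g hg hg'
    obtain ⟨b, hb⟩ := hB
    obtain ⟨x, hx⟩ := Option.isSome_iff_exists.1 ((hg.1 b).2 hb)
    exact Set.disjoint_left.1 h (hg.2.1 b x hx) (hg'.2.1 b x hx)

theorem occCount_empty {α : Type*} [LT α] (f : α → α) (S : Set α) : occCount f S ∅ = 1 := by
  rw [occCount, Set.ncard_eq_one]
  refine ⟨fun _ => none, Set.eq_singleton_iff_unique_mem.2 ⟨⟨?_, ?_, ?_⟩, fun g hg => ?_⟩⟩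
  · simp
  · simp
  · simp
  · funext b
    have := hg.1 b
    simpa using this

theorem occCount_singleton {α : Type*} [Finite α] [Preorder α] (f : α → α) (S : Set α) (c : Fin 4) :
    occCount f S {c} = S.ncard := by
  have : partialOccurrences f S {c} = (fun x b => if b = c then some x else none) '' S := by
    ext g
    constructor
    · rintro ⟨h1, h2, -⟩
      obtain ⟨x, hx⟩ := Option.isSome_iff_exists.1 ((h1 c).2 (Finset.mem_singleton_self c))
      refine ⟨x, h2 c x hx, funext fun b => ?_⟩
      by_cases hb : b = c
      · simp [hb, hx]
      · have := h1 b
        simp only [Finset.mem_singleton, hb, iff_false, Option.not_isSome_iff_eq_none] at this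
        simp [hb, this]
    · rintro ⟨x, hx, rfl⟩
      refine ⟨fun b => ?_, fun b y hy => ?_, fun a b y z hy hz => ?_⟩
      · by_cases hb : b = c <;> simp [hb]
      · by_cases hb : b = c <;> simp_all
      · by_cases hb : b = c <;> by_cases ha : a = c <;> simp_all
  rw [occCount, this, Set.ncard_image_of_injective]
  intro x y h
  simpa using congrFun h c

/-- The letters of `B` may be distributed over blocks according to `h`: letters in different blocks
are in the relative order that the pattern prescribes. -/
def BlockCompat {ι : Type*} (pos val : ι → ℕ) (B : Finset (Fin 4)) (h : Fin 4 → Option ι) : Prop :=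
  (∀ b, (h b).isSome ↔ b ∈ B) ∧ ∀ a b i j, h a = some i → h b = some j → i ≠ j →
    (pos i < pos j ↔ a < b) ∧ (val i < val j ↔ pattern3412 a < pattern3412 b)

-- Sort the partial occurrences by the map `h` that records the block of each letter. Comparisons
-- across blocks depend on `h` alone, so for a compatible `h` the placements inside the blocks are
-- independent of each other and their numbers multiply.
open Classical in
theorem occCount_eq_sum_blocks {α ι : Type*} [Finite α] [Preorder α] [Fintype ι]
    (f : α → α) (β : α → ι) (pos val : ι → ℕ)
    (hpos : ∀ x y, β x ≠ β y → (x < y ↔ pos (β x) < pos (β y)))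
    (hval : ∀ x y, β x ≠ β y → (f x < f y ↔ val (β x) < val (β y))) (B : Finset (Fin 4)) :
    occCount f Set.univ B = ∑ h ∈ Finset.univ.filter (BlockCompat pos val B),
      ∏ i, occCount f (β ⁻¹' {i}) (Finset.univ.filter fun b => h b = some i) := by
  have := Fintype.ofFinite α
  rw [occCount, Set.ncard_eq_toFinset_card',
    Finset.card_eq_sum_card_fiberwise (f := fun g b => (g b).map β)
      (t := Finset.univ.filter (BlockCompat pos val B))]
  · refine Finset.sum_congr rfl fun h hh => ?_
    obtain ⟨hB, hc⟩ := (Finset.mem_filter.1 hh).2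
    simp only [occCount, ← Nat.card_coe_set_eq]
    rw [← Nat.card_pi, ← Nat.card_eq_finsetCard]
    refine Nat.card_congr
      { toFun := fun g i => ⟨fun b => if h b = some i then g.1 b else none, ?_⟩
        invFun := fun F => ⟨fun b => (h b).bind fun i => (F i).1 b, ?_⟩
        left_inv := ?_
        right_inv := ?_ }
    · obtain ⟨g, hg⟩ := g
      simp only [Finset.mem_filter, Set.mem_toFinset] at hg
      obtain ⟨⟨h1, -, h3⟩, h4⟩ := hg
      have h4 : ∀ b, (g b).map β = h b := congrFun h4
      refine ⟨fun b => ?_, fun b x hx => ?_, fun a b x y hx hy => ?_⟩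
      · by_cases hb : h b = some i
        · have := h4 b
          simp only [hb, if_true, Finset.mem_filter, Finset.mem_univ, true_and, iff_true]
          rw [← Option.isSome_map (f := β), this, hb, Option.isSome_some]
        · simp [hb]
      · by_cases hb : h b = some i
        · have := h4 b
          simp only [hb, if_true] at hx this
          simpa [hx] using this
        · simp [hb] at hx
      · by_cases ha : h a = some i
        · by_cases hb : h b = some i
          · simp only [ha, hb, if_true] at hx hy
            exact h3 a b x y hx hy
          · simp [hb] at hy
        · simp [ha] at hx
    · have key : ∀ b x, ((h b).bind fun i => (F i).1 b) = some x →
          ∃ i, h b = some i ∧ (F i).1 b = some x ∧ β x = i := by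
        intro b x hx
        obtain ⟨i, hi, hx⟩ := Option.bind_eq_some_iff.1 hx
        exact ⟨i, hi, hx, (F i).2.2.1 b x hx⟩
      have hsome : ∀ b i, h b = some i → ∃ x, (F i).1 b = some x := by
        intro b i hi
        exact Option.isSome_iff_exists.1 (((F i).2.1 b).2 (by simp [hi]))
      simp only [Finset.mem_filter, Set.mem_toFinset]
      refine ⟨⟨fun b => ?_, fun _ _ _ => trivial, fun a b x y hx hy => ?_⟩, funext fun b => ?_⟩
      · rw [← hB b]
        change ((h b).bind _).isSome ↔ _
        rcases hb : h b with _ | i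
        · exact Iff.rfl
        · obtain ⟨x, hx⟩ := hsome b i hb
          rw [Option.bind_some, hx]
          exact iff_of_true rfl rfl
      · obtain ⟨i, hi, hx, hxi⟩ := key a x hx
        obtain ⟨j, hj, hy, hyj⟩ := key b y hy
        by_cases hij : i = j
        · subst hij
          exact (F i).2.2.2 a b x y hx hy
        · have hne : β x ≠ β y := by rwa [hxi, hyj]
          rw [hpos x y hne, hval x y hne, hxi, hyj]
          exact hc a b i j hi hj hij
      · rcases hb : h b with _ | i
        · simp
        · obtain ⟨x, hx⟩ := hsome b i hb
          have := (F i).2.2.1 b x hx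
          simp only [Set.mem_preimage, Set.mem_singleton_iff] at this
          simp [hx, this]
    · rintro ⟨g, hg⟩
      simp only [Finset.mem_filter, Set.mem_toFinset] at hg
      have h4 : ∀ b, (g b).map β = h b := congrFun hg.2
      ext1
      funext b
      rcases hb : h b with _ | i
      · have := h4 b
        rw [hb, Option.map_eq_none_iff] at this
        simp [this]
      · simp [hb]
    · intro F
      funext i
      ext1
      funext b
      by_cases hb : h b = some i
      · simp [hb]
      · have := (F i).2.1 b
        simp only [Finset.mem_filter, Finset.mem_univ, true_and, hb, iff_false,
          Option.not_isSome_iff_eq_none] at this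
        simp [hb, this]
  · intro g hg
    have hg : g ∈ partialOccurrences f Set.univ B := by simpa using hg
    simp only [Finset.coe_filter, Finset.mem_univ, true_and, Set.mem_ofPred_eq]
    refine ⟨fun b => by rw [Option.isSome_map, hg.1], fun a b i j hi hj hij => ?_⟩
    obtain ⟨x, hx, rfl⟩ := Option.map_eq_some_iff.1 hi
    obtain ⟨y, hy, rfl⟩ := Option.map_eq_some_iff.1 hj
    rw [← hpos x y hij, ← hval x y hij]
    exact hg.2.2 a b x y hx hy

/-! ### Involutions of all sizes, and words with blocks in the gaps -/

/-- Involutions of the letters `0, …, n - 1`, for all `n` at once. -/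
abbrev Invol := Σ n : ℕ, {f : Fin n → Fin n // Function.Involutive f}

theorem Invol.eq_of_equiv {s t : Invol} (e : Fin s.1 ≃o Fin t.1)
    (he : ∀ x, e (s.2.1 x) = t.2.1 (e x)) : s = t := by
  obtain ⟨n, f, hf⟩ := s
  obtain ⟨m, g, hg⟩ := t
  have hnm : n = m := by simpa using Fintype.card_congr e.toEquiv
  subst hnm
  have h1 : ∀ x, e x = x := fun x => by
    rw [Subsingleton.elim e (OrderIso.refl _)]; rfl
  have h2 : f = g := funext fun x => by simpa [h1] using he x
  subst h2
  rfl

theorem Invol.eq_of_strictMono {s t : Invol} (u : Fin s.1 → Fin t.1) (hu : StrictMono u)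
    (hle : t.1 ≤ s.1) (h : ∀ x, u (s.2.1 x) = t.2.1 (u x)) : s = t := by
  have hb : Function.Bijective u := (Fintype.bijective_iff_injective_and_card u).2
    ⟨hu.injective, by
      have := Fintype.card_le_of_injective u hu.injective
      simp only [Fintype.card_fin] at this ⊢
      omega⟩
  exact Invol.eq_of_equiv (hu.orderIsoOfSurjective u hb.surjective) h

section Standardize
variable {α : Type*} [Fintype α] [LinearOrder α]

/-- The involution of `0, …, n - 1` isomorphic to an involution of a finite linear order. -/
def standardize (f : α → α) (hf : Function.Involutive f) : Invol :=
  ⟨Fintype.card α, fun x => (Fintype.orderIsoFinOfCardEq α rfl).symm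
    (f (Fintype.orderIsoFinOfCardEq α rfl x)), fun x => by simp [hf (_ : α)]⟩

/-- The order isomorphism that defines `standardize`. -/
def standardizeIso (f : α → α) (hf : Function.Involutive f) : Fin (standardize f hf).1 ≃o α :=
  Fintype.orderIsoFinOfCardEq α rfl

theorem standardizeIso_apply (f : α → α) (hf : Function.Involutive f) (x) :
    standardizeIso f hf ((standardize f hf).2.1 x) = f (standardizeIso f hf x) := by
  exact (Fintype.orderIsoFinOfCardEq α rfl).apply_symm_apply _

end Standardize

/-- `k` letters, the `i`-th of which is followed by a block of `n i` letters. -/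
abbrev BlockWord {k : ℕ} (n : Fin k → ℕ) := Σₗ i : Fin k, WithBot (Fin (n i))

namespace BlockWord
variable {k : ℕ} {n : Fin k → ℕ}

/-- The `i`-th letter outside the blocks. -/
def pt (i : Fin k) : BlockWord n := toLex ⟨i, ⊥⟩

/-- A letter of the `i`-th block. -/
def gap (i : Fin k) (a : Fin (n i)) : BlockWord n := toLex ⟨i, (a : WithBot (Fin (n i)))⟩

theorem cases_pt_gap {P : BlockWord n → Prop} (hp : ∀ i, P (pt i)) (hg : ∀ i a, P (gap i a)) (x) :
    P x := by
  obtain ⟨i, a⟩ := x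
  induction a with
  | bot => exact hp i
  | coe a => exact hg i a

theorem pt_lt_pt {i j : Fin k} : (pt i : BlockWord n) < pt j ↔ i < j := by
  rw [Sigma.Lex.lt_def]
  constructor
  · rintro (h | ⟨h, h'⟩)
    · exact h
    · cases (show i = j from h)
      exact absurd h' (lt_irrefl _)
  · exact Or.inl

theorem pt_lt_gap {i j : Fin k} {b : Fin (n j)} : (pt i : BlockWord n) < gap j b ↔ i ≤ j := by
  rw [Sigma.Lex.lt_def]
  constructor
  · rintro (h | ⟨h, h'⟩)
    · exact le_of_lt h
    · exact le_of_eq h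
  · intro h
    rcases h.lt_or_eq with h | rfl
    · exact Or.inl h
    · exact Or.inr ⟨rfl, WithBot.bot_lt_coe b⟩

theorem gap_lt_pt {i j : Fin k} {a : Fin (n i)} : (gap i a : BlockWord n) < pt j ↔ i < j := by
  rw [Sigma.Lex.lt_def]
  constructor
  · rintro (h | ⟨h, h'⟩)
    · exact h
    · cases (show i = j from h)
      exact absurd h' not_lt_bot
  · exact Or.inl

theorem gap_lt_gap_same {i : Fin k} {a b : Fin (n i)} :
    (gap i a : BlockWord n) < gap i b ↔ a < b := by
  rw [Sigma.Lex.lt_def]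
  constructor
  · rintro (h | ⟨h, h'⟩)
    · exact absurd h (lt_irrefl _)
    · exact WithBot.coe_lt_coe.1 h'
  · exact fun h => Or.inr ⟨rfl, WithBot.coe_lt_coe.2 h⟩

theorem gap_lt_gap {i j : Fin k} (hij : i ≠ j) {a : Fin (n i)} {b : Fin (n j)} :
    (gap i a : BlockWord n) < gap j b ↔ i < j := by
  rw [Sigma.Lex.lt_def]
  constructor
  · rintro (h | ⟨h, h'⟩)
    · exact h
    · exact absurd h hij
  · exact Or.inl

theorem gap_injective (i : Fin k) : Function.Injective (gap i : Fin (n i) → BlockWord n) := by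
  intro a b h
  have h1 : ¬ a < b := fun h' => (gap_lt_gap_same.2 h').ne h
  have h2 : ¬ b < a := fun h' => (gap_lt_gap_same.2 h').ne h.symm
  exact le_antisymm (not_lt.1 h2) (not_lt.1 h1)

theorem pt_injective : Function.Injective (pt : Fin k → BlockWord n) := by
  intro a b h
  exact congrArg (fun x : BlockWord n => (ofLex x).1) h

theorem pt_ne_gap {i j : Fin k} {a : Fin (n j)} : (pt i : BlockWord n) ≠ gap j a := by
  intro h
  have h1 : i = j := congrArg (fun x : BlockWord n => (ofLex x).1) h
  subst h1
  exact absurd h (pt_lt_gap.2 le_rfl).ne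

theorem card_eq : Fintype.card (BlockWord n) = k + ∑ i, n i := by
  change Fintype.card (Σ i : Fin k, WithBot (Fin (n i))) = _
  rw [Fintype.card_sigma]
  have : ∀ i, Fintype.card (WithBot (Fin (n i))) = n i + 1 := fun i => by
    rw [show Fintype.card (WithBot (Fin (n i))) = Fintype.card (Option (Fin (n i))) from
      Fintype.card_congr (Equiv.refl _)]
    simp
  simp only [this, Finset.sum_add_distrib]
  simp [add_comm]

/-- The letters outside the blocks are permuted by `C` and the `i`-th block by `s i`. -/
def inflate (C : Fin k → Fin k) (s : ∀ i, Fin (n i) → Fin (n i)) (x : BlockWord n) : BlockWord n :=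
  WithBot.recBotCoe (C := fun _ => BlockWord n) (pt (C (ofLex x).1))
    (fun a => gap (ofLex x).1 (s (ofLex x).1 a)) (ofLex x).2

@[simp] theorem inflate_pt (C : Fin k → Fin k) (s : ∀ i, Fin (n i) → Fin (n i)) (i : Fin k) :
    inflate C s (pt i) = pt (C i) := rfl

@[simp] theorem inflate_gap (C : Fin k → Fin k) (s : ∀ i, Fin (n i) → Fin (n i)) (i : Fin k)
    (a : Fin (n i)) : inflate C s (gap i a) = gap i (s i a) := rfl

theorem inflate_involutive {C : Fin k → Fin k} {s : ∀ i, Fin (n i) → Fin (n i)}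
    (hC : Function.Involutive C) (hs : ∀ i, Function.Involutive (s i)) :
    Function.Involutive (inflate C s) := by
  intro x
  induction x using cases_pt_gap with
  | hp i => simp [hC i]
  | hg i a => simp [hs i a]

end BlockWord

/-! ### The component of the first letter and the unique decomposition -/

section Core
variable {α : Type*} [LinearOrder α]

/-- `K` contains the first letter, is `f`-invariant, and no pair `x, f x` of letters outside `K`
is separated by an element of `K`. -/
structure RootedClosed (f : α → α) (K : Set α) : Prop where
  map_mem : ∀ x ∈ K, f x ∈ K
  lt_iff : ∀ x ∉ K, ∀ y ∈ K, x < y ↔ f x < y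
  bot : ∃ y ∈ K, ∀ z, y ≤ z

/-- The smallest rooted closed set. -/
def core (f : α → α) : Set α := {x | ∀ K, RootedClosed f K → x ∈ K}

theorem rootedClosed_core [Finite α] [Nonempty α] (f : α → α) : RootedClosed f (core f) := by
  refine ⟨fun x hx K hK => hK.map_mem x (hx K hK), fun x hx y hy => ?_, ?_⟩
  · simp only [core, Set.mem_ofPred_eq, not_forall] at hx
    obtain ⟨K, hK, hxK⟩ := hx
    exact hK.lt_iff x hxK y (hy K hK)
  · obtain ⟨y, hy⟩ := Finite.exists_min (id : α → α)
    refine ⟨y, fun K hK => ?_, hy⟩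
    obtain ⟨z, hz, hz'⟩ := hK.bot
    rwa [show y = z from le_antisymm (hy z) (hz' y)]

theorem RootedClosed.preimage {β : Type*} [LinearOrder β] {f : α → α} {g : β → β} (e : β ≃o α)
    (he : ∀ x, e (g x) = f (e x)) {K : Set α} (hK : RootedClosed f K) :
    RootedClosed g (e ⁻¹' K) := by
  refine ⟨fun x hx => ?_, fun x hx y hy => ?_, ?_⟩
  · rw [Set.mem_preimage, he]
    exact hK.map_mem _ hx
  · have := hK.lt_iff _ hx _ hy
    rwa [← he, e.lt_iff_lt, e.lt_iff_lt] at this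
  · obtain ⟨z, hz, hz'⟩ := hK.bot
    refine ⟨e.symm z, by simpa using hz, fun w => ?_⟩
    rw [e.symm_apply_le]
    exact hz' _

theorem mem_core_of_equiv {β : Type*} [LinearOrder β] {f : α → α} {g : β → β} (e : β ≃o α)
    (he : ∀ x, e (g x) = f (e x)) {x : β} (hx : x ∈ core g) : e x ∈ core f :=
  fun _ hK => hx _ (hK.preimage e he)

end Core

/-- Involutions that are spanned by the component of the first letter. -/
abbrev Conn (k : ℕ) := {C : Fin k → Fin k // Function.Involutive C ∧ 0 < k ∧
  ∀ K : Set (Fin k), RootedClosed C K → K = Set.univ}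

open BlockWord

/-- The component is rooted closed because each block is invariant and sits inside one gap.
Conversely, a rooted closed set meets the component in a rooted closed set for `C`, which is
everything by connectedness. -/
theorem core_inflate {k : ℕ} {n : Fin k → ℕ} (C : Conn k) (s : ∀ i, Fin (n i) → Fin (n i)) :
    core (inflate C.1 s) = Set.range pt := by
  obtain ⟨C, hC, hk, hconn⟩ := C
  have hbot : ∀ z : BlockWord n, pt ⟨0, hk⟩ ≤ z := by
    intro z
    induction z using cases_pt_gap with
    | hp i => rw [← not_lt, pt_lt_pt]; exact not_lt.2 (Fin.mk_le_of_le_val (Nat.zero_le _))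
    | hg i a => exact (pt_lt_gap.2 (Fin.mk_le_of_le_val (Nat.zero_le _))).le
  apply Set.Subset.antisymm
  · intro x hx
    refine hx _ ⟨?_, ?_, ?_⟩
    · rintro _ ⟨i, rfl⟩
      exact ⟨C i, (inflate_pt ..).symm⟩
    · intro x hx
      rintro _ ⟨j, rfl⟩
      induction x using cases_pt_gap with
      | hp i => exact absurd ⟨i, rfl⟩ hx
      | hg i a => rw [inflate_gap, gap_lt_pt, gap_lt_pt]
    · exact ⟨_, ⟨⟨0, hk⟩, rfl⟩, hbot⟩
  · rintro _ ⟨i, rfl⟩ K hK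
    have : RootedClosed C (pt ⁻¹' K) := by
      refine ⟨fun j hj => ?_, fun j hj l hl => ?_, ?_⟩
      · have := hK.map_mem _ hj
        rwa [inflate_pt] at this
      · have := hK.lt_iff _ hj _ hl
        rwa [inflate_pt, pt_lt_pt, pt_lt_pt] at this
      · obtain ⟨y, hy, hy'⟩ := hK.bot
        refine ⟨⟨0, hk⟩, ?_, fun z => Fin.mk_le_of_le_val (Nat.zero_le _)⟩
        rwa [Set.mem_preimage, le_antisymm (hbot y) (hy' _)]
    have := hconn _ this
    exact (this ▸ Set.mem_univ i : i ∈ pt ⁻¹' K)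

/-- The involution with component `C` of the first letter and with the given blocks in its gaps. -/
def assemble {k : ℕ} (C : Conn k) (σ : Fin k → Invol) : Invol :=
  standardize (inflate (n := fun i => (σ i).1) C.1 (fun i => (σ i).2.1))
    (inflate_involutive C.2.1 fun i => (σ i).2.2)

theorem assemble_size {k : ℕ} (C : Conn k) (σ : Fin k → Invol) :
    (assemble C σ).1 = k + ∑ i, (σ i).1 := card_eq

theorem assemble_iso {k : ℕ} (C : Conn k) (σ : Fin k → Invol) :
    ∃ e : Fin (assemble C σ).1 ≃o BlockWord (fun i => (σ i).1),
      ∀ x, e ((assemble C σ).2.1 x) = inflate C.1 (fun i => (σ i).2.1) (e x) :=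
  ⟨standardizeIso _ _, standardizeIso_apply _ _⟩

theorem gap_map_of_equiv {k : ℕ} {n m : Fin k → ℕ} (e : BlockWord n ≃o BlockWord m)
    (he : ∀ i, e (pt i) = pt i) (i : Fin k) (a : Fin (n i)) : ∃ b, e (gap i a) = gap i b := by
  have key : ∀ j, j ≤ i ↔ (pt j : BlockWord m) < e (gap i a) := by
    intro j
    rw [← he j, e.lt_iff_lt, pt_lt_gap]
  generalize hx : e (gap i a) = x at key
  induction x using cases_pt_gap with
  | hp j =>
    rw [← he j] at hx
    exact absurd (e.injective hx) pt_ne_gap.symm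
  | hg j b =>
    have : i = j := by
      have h1 := (key i).1 le_rfl
      have h2 := (key j).2 (pt_lt_gap.2 le_rfl)
      exact le_antisymm (pt_lt_gap.1 h1) h2
    subst this
    exact ⟨b, rfl⟩

theorem exists_gap_strictMono {k : ℕ} {σ τ : Fin k → Invol} {C : Fin k → Fin k}
    (e : BlockWord (fun i => (σ i).1) ≃o BlockWord (fun i => (τ i).1))
    (hpt : ∀ i, e (pt i) = pt i)
    (he : ∀ x, e (inflate C (fun i => (σ i).2.1) x) = inflate C (fun i => (τ i).2.1) (e x))
    (i : Fin k) : ∃ u : Fin (σ i).1 → Fin (τ i).1, StrictMono u ∧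
      ∀ x, u ((σ i).2.1 x) = (τ i).2.1 (u x) := by
  choose u hu using fun a => gap_map_of_equiv e hpt i a
  refine ⟨u, fun a b hab => ?_, fun a => ?_⟩
  · rw [← gap_lt_gap_same (n := fun i => (τ i).1), ← hu, ← hu, e.lt_iff_lt, gap_lt_gap_same]
    exact hab
  · apply gap_injective (n := fun i => (τ i).1) i
    rw [← hu]
    have := he (gap i a)
    rwa [inflate_gap, hu a, inflate_gap] at this

/-- The core is defined by order and involution alone, so an isomorphism of assembled words carries
component to component. Finite chains are rigid, so it fixes each component letter, hence each gap,
and restricts to an embedding of the blocks in each gap; the inverse gives the reverse inequality of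
sizes. -/
theorem assemble_injective {k k' : ℕ} {C : Conn k} {C' : Conn k'} {σ : Fin k → Invol}
    {σ' : Fin k' → Invol} (h : assemble C σ = assemble C' σ') :
    (⟨k, C, σ⟩ : Σ k, Conn k × (Fin k → Invol)) = ⟨k', C', σ'⟩ := by
  obtain ⟨e, he⟩ : ∃ e : BlockWord (fun i => (σ i).1) ≃o BlockWord (fun i => (σ' i).1),
      ∀ x, e (inflate C.1 (fun i => (σ i).2.1) x) = inflate C'.1 (fun i => (σ' i).2.1) (e x) := by
    obtain ⟨e, he⟩ := assemble_iso C σ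
    have h' := assemble_iso C' σ'
    rw [← h] at h'
    obtain ⟨e', he'⟩ := h'
    refine ⟨e.symm.trans e', fun x => ?_⟩
    obtain ⟨y, rfl⟩ := e.surjective x
    rw [OrderIso.trans_apply, OrderIso.trans_apply, ← he, e.symm_apply_apply,
      e.symm_apply_apply, he']
  have he' : ∀ x, e.symm (inflate C'.1 (fun i => (σ' i).2.1) x)
      = inflate C.1 (fun i => (σ i).2.1) (e.symm x) := by
    intro x
    rw [e.symm_apply_eq, he, e.apply_symm_apply]
  have h1 : ∀ i, ∃ j, e (pt i) = pt j := by
    intro i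
    have := mem_core_of_equiv e he (x := pt i) (by rw [core_inflate]; exact ⟨i, rfl⟩)
    rw [core_inflate] at this
    exact this.imp fun _ h => h.symm
  have h2 : ∀ i, ∃ j, e.symm (pt i) = pt j := by
    intro i
    have := mem_core_of_equiv e.symm he' (x := pt i) (by rw [core_inflate]; exact ⟨i, rfl⟩)
    rw [core_inflate] at this
    exact this.imp fun _ h => h.symm
  choose u hu using h1
  have hu_mono : StrictMono u := fun a b hab => by
    rw [← pt_lt_pt (n := fun i => (σ' i).1), ← hu, ← hu, e.lt_iff_lt, pt_lt_pt]
    exact hab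
  have hu_surj : Function.Surjective u := by
    intro j
    obtain ⟨i, hi⟩ := h2 j
    refine ⟨i, pt_injective (n := fun i => (σ' i).1) ?_⟩
    rw [← hu, ← hi, e.apply_symm_apply]
  have hk : k = k' := by
    simpa using Fintype.card_congr (Equiv.ofBijective u ⟨hu_mono.injective, hu_surj⟩)
  subst hk
  have hid : ∀ i, u i = i := fun i => by
    have : hu_mono.orderIsoOfSurjective u hu_surj = OrderIso.refl _ := Subsingleton.elim _ _
    exact DFunLike.congr_fun this i
  have hpt : ∀ i, e (pt i) = pt i := fun i => by rw [hu, hid]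
  have hpt' : ∀ i, e.symm (pt i) = pt i := fun i => by rw [e.symm_apply_eq, hpt]
  have hC : C = C' := by
    apply Subtype.ext
    funext i
    have := he (pt i)
    rw [inflate_pt, hpt, hpt, inflate_pt] at this
    exact pt_injective this
  subst hC
  have hσ : σ = σ' := by
    funext i
    obtain ⟨u, hu, hu'⟩ := exists_gap_strictMono e hpt he i
    obtain ⟨v, hv, -⟩ := exists_gap_strictMono e.symm hpt' he' i
    exact Invol.eq_of_strictMono u hu
      (by simpa using Fintype.card_le_of_injective v hv.injective) hu'
  subst hσ
  rfl

/-- The component is the standardized core, and the letters outside the core are grouped by the last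
core letter before them. These groups are invariant because no core letter separates `x` from `f x`.
-/
theorem exists_assemble (t : Invol) (ht : 0 < t.1) :
    ∃ k, ∃ C : Conn k, ∃ σ : Fin k → Invol, assemble C σ = t := by
  classical
  obtain ⟨n, f, hf⟩ := t
  have : Nonempty (Fin n) := ⟨⟨0, ht⟩⟩
  have hcore := rootedClosed_core f
  have := Fintype.ofFinite (core f)
  set k := Fintype.card (core f) with hk
  let κ : Fin k ≃o core f := Fintype.orderIsoFinOfCardEq _ rfl
  let C : Fin k → Fin k := fun i => κ.symm ⟨f (κ i), hcore.map_mem _ (κ i).2⟩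
  have hκC : ∀ i, (κ (C i) : Fin n) = f (κ i) := fun i => by simp [C]
  obtain ⟨b, hb, hb'⟩ := hcore.bot
  have hk0 : 0 < k := Fintype.card_pos_iff.2 ⟨⟨b, hb⟩⟩
  -- A rooted closed subset of the core is rooted closed in the whole word, so minimality of the
  -- core makes it everything.
  have hCconn : ∀ K : Set (Fin k), RootedClosed C K → K = Set.univ := by
    intro K hK
    have hK' : RootedClosed f ((fun i => (κ i : Fin n)) '' K) := by
      refine ⟨?_, fun x hx => ?_, ?_⟩
      · rintro _ ⟨i, hi, rfl⟩
        exact ⟨C i, hK.map_mem i hi, hκC i⟩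
      · rintro _ ⟨j, hj, rfl⟩
        by_cases hxc : x ∈ core f
        · obtain ⟨i, hi⟩ := κ.surjective ⟨x, hxc⟩
          obtain rfl : (κ i : Fin n) = x := congrArg Subtype.val hi
          have hiK : i ∉ K := fun h => hx ⟨i, h, rfl⟩
          have := hK.lt_iff i hiK j hj
          rw [← hκC]
          simpa using this
        · exact hcore.lt_iff x hxc _ (κ j).2
      · obtain ⟨y, hy, hy'⟩ := hK.bot
        refine ⟨_, ⟨y, hy, rfl⟩, fun z => le_trans ?_ (hb' z)⟩
        have := hy' (κ.symm ⟨b, hb⟩)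
        rw [κ.le_symm_apply] at this
        exact this
    ext i
    simp only [Set.mem_univ, iff_true]
    obtain ⟨j, hj, hji⟩ := (κ i).2 _ hK'
    rwa [← κ.injective (Subtype.ext hji)]
  have hCinv : Function.Involutive C := fun i => by
    apply κ.injective
    apply Subtype.ext
    rw [hκC, hκC, hf]
  let G : Fin k → Set (Fin n) := fun i => {x | x ∉ core f ∧ ∀ j, (κ j : Fin n) < x ↔ j ≤ i}
  have hGf : ∀ i, ∀ x ∈ G i, f x ∈ G i := by
    rintro i x ⟨hx, hx'⟩
    have hfx : f x ∉ core f := fun h => hx (by simpa [hf x] using hcore.map_mem _ h)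
    refine ⟨hfx, fun j => ?_⟩
    rw [← hx' j]
    have h1 := hcore.lt_iff x hx _ (κ j).2
    have h2 : (κ j : Fin n) ≠ x := fun h => hx (h ▸ (κ j).2)
    have h3 : (κ j : Fin n) ≠ f x := fun h => hfx (h ▸ (κ j).2)
    constructor
    · intro h
      exact lt_of_le_of_ne (not_lt.1 fun h' => (h1.1 h').asymm h) h2
    · intro h
      exact lt_of_le_of_ne (not_lt.1 fun h' => (h1.2 h').asymm h) h3
  let φ : ∀ i, G i → G i := fun i x => ⟨f x, hGf i x x.2⟩
  have hφ : ∀ i, Function.Involutive (φ i) := fun i x => Subtype.ext (hf _)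
  let σ : Fin k → Invol := fun i => standardize (φ i) (hφ i)
  let γ : ∀ i, Fin (σ i).1 ≃o G i := fun i => standardizeIso (φ i) (hφ i)
  have hγ : ∀ i a, (γ i ((σ i).2.1 a) : Fin n) = f (γ i a) := fun i a =>
    congrArg Subtype.val (standardizeIso_apply (φ i) (hφ i) a)
  let E : BlockWord (fun i => (σ i).1) → Fin n := fun x =>
    WithBot.recBotCoe (κ (ofLex x).1 : Fin n) (fun a => (γ (ofLex x).1 a : Fin n)) (ofLex x).2
  have Ept : ∀ i, E (pt i) = κ i := fun _ => rfl
  have Egap : ∀ i a, E (gap i a) = γ i a := fun _ _ => rfl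
  have hE : StrictMono E := by
    intro x y
    induction x using cases_pt_gap with
    | hp i =>
      induction y using cases_pt_gap with
      | hp j =>
        rw [pt_lt_pt, Ept, Ept]
        intro h
        exact κ.lt_iff_lt.2 h
      | hg j b =>
        rw [pt_lt_gap, Ept, Egap]
        exact ((γ j b).2.2 i).2
    | hg i a =>
      induction y using cases_pt_gap with
      | hp j =>
        rw [gap_lt_pt, Ept, Egap]
        intro h
        refine lt_of_le_of_ne (not_lt.1 fun h' => h.not_ge (((γ i a).2.2 j).1 h')) fun h' => ?_
        exact (γ i a).2.1 (h' ▸ (κ j).2)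
      | hg j b =>
        by_cases hij : i = j
        · subst hij
          rw [gap_lt_gap_same, Egap, Egap]
          intro h
          exact (γ i).lt_iff_lt.2 h
        · rw [gap_lt_gap hij, Egap, Egap]
          intro h
          refine lt_of_le_of_lt (not_lt.1 fun h' => ?_) (((γ j b).2.2 j).2 le_rfl)
          exact h.not_ge (((γ i a).2.2 j).1 h')
  have hEs : Function.Surjective E := by
    intro x
    by_cases hx : x ∈ core f
    · exact ⟨pt (κ.symm ⟨x, hx⟩), by rw [Ept, κ.apply_symm_apply]⟩
    -- The first letter belongs to the core, so every other letter is preceded by some core letter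
    -- and there is no gap at the front.
    · have hne : (Finset.univ.filter fun j => (κ j : Fin n) < x).Nonempty := by
        refine ⟨κ.symm ⟨b, hb⟩, ?_⟩
        simp only [Finset.mem_filter, Finset.mem_univ, true_and, κ.apply_symm_apply]
        exact lt_of_le_of_ne (hb' x) fun h => hx (h ▸ hb)
      obtain ⟨i, hi, hi'⟩ := Finset.exists_max_image _ id hne
      have hxG : x ∈ G i := by
        refine ⟨hx, fun j => ⟨fun h => hi' j (by simpa using h), fun h => ?_⟩⟩
        refine lt_of_le_of_lt ?_ (Finset.mem_filter.1 hi).2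
        exact κ.le_iff_le.2 h
      exact ⟨gap i ((γ i).symm ⟨x, hxG⟩), by rw [Egap, (γ i).apply_symm_apply]⟩
  refine ⟨k, ⟨C, hCinv, hk0, hCconn⟩, σ, ?_⟩
  obtain ⟨e, he⟩ := assemble_iso ⟨C, hCinv, hk0, hCconn⟩ σ
  refine Invol.eq_of_equiv (e.trans (hE.orderIsoOfSurjective E hEs)) fun x => ?_
  refine (congrArg E (he x)).trans ?_
  change _ = f (E (e x))
  generalize e x = y
  induction y using cases_pt_gap with
  | hp i => rw [inflate_pt, Ept, Ept, hκC]
  | hg i a => rw [inflate_gap, Egap, Egap, hγ]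

/-! ### Arithmetic of natural numbers up to a cap -/

/-- `a` and `b` are equal or both at least `c`. -/
def CapEq (c a b : ℕ) : Prop := a = b ∨ (c ≤ a ∧ c ≤ b)

theorem capEq_iff {c a b : ℕ} : CapEq c a b ↔ min a c = min b c := by
  unfold CapEq; omega

theorem CapEq.add {c a b a' b' : ℕ} (h : CapEq c a b) (h' : CapEq c a' b') :
    CapEq c (a + a') (b + b') := by
  unfold CapEq at *; omega

/-- A product of a number at the cap with a nonzero number is still at the cap. Zero factors are
treated apart: for positive `c`, a number is zero exactly when its partner is. -/
theorem CapEq.mul {c a b a' b' : ℕ} (h : CapEq c a b) (h' : CapEq c a' b') :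
    CapEq c (a * a') (b * b') := by
  have key : ∀ x y : ℕ, c ≤ x → y ≠ 0 → c ≤ x * y := fun x y hx hy =>
    hx.trans (Nat.le_mul_of_pos_right x (Nat.pos_of_ne_zero hy))
  by_cases ha : a = 0 ∧ b = 0
  · simp [ha.1, ha.2, CapEq]
  by_cases ha' : a' = 0 ∧ b' = 0
  · simp [ha'.1, ha'.2, CapEq]
  rcases h with rfl | ⟨h1, h2⟩
  · rcases h' with rfl | ⟨h3, h4⟩
    · exact Or.inl rfl
    · right
      rw [mul_comm a, mul_comm a]
      exact ⟨key _ _ h3 (by tauto), key _ _ h4 (by tauto)⟩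
  · rcases Nat.eq_zero_or_pos c with rfl | hc
    · exact Or.inr ⟨Nat.zero_le _, Nat.zero_le _⟩
    · rcases h' with rfl | ⟨h3, h4⟩
      · exact Or.inr ⟨key _ _ h1 (by tauto), key _ _ h2 (by tauto)⟩
      · exact Or.inr ⟨key _ _ h1 (by omega), key _ _ h2 (by omega)⟩

theorem CapEq.sum {ι : Type*} {c : ℕ} (s : Finset ι) {a b : ι → ℕ}
    (h : ∀ i ∈ s, CapEq c (a i) (b i)) : CapEq c (∑ i ∈ s, a i) (∑ i ∈ s, b i) := by
  classical
  induction s using Finset.induction_on with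
  | empty => exact Or.inl rfl
  | insert i s hi ih =>
    rw [Finset.sum_insert hi, Finset.sum_insert hi]
    exact (h i (Finset.mem_insert_self i s)).add
      (ih fun j hj => h j (Finset.mem_insert_of_mem hj))

theorem CapEq.prod {ι : Type*} {c : ℕ} (s : Finset ι) {a b : ι → ℕ}
    (h : ∀ i ∈ s, CapEq c (a i) (b i)) : CapEq c (∏ i ∈ s, a i) (∏ i ∈ s, b i) := by
  classical
  induction s using Finset.induction_on with
  | empty => exact Or.inl rfl
  | insert i s hi ih =>
    rw [Finset.prod_insert hi, Finset.prod_insert hi]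
    exact (h i (Finset.mem_insert_self i s)).mul
      (ih fun j hj => h j (Finset.mem_insert_of_mem hj))

/-! ### Counts of an assembled word in terms of its blocks -/

/-- The number of partial occurrences of `3412` in an involution. -/
noncomputable def Invol.count (t : Invol) (B : Finset (Fin 4)) : ℕ := occCount t.2.1 Set.univ B

theorem Invol.count_empty (t : Invol) : t.count ∅ = 1 := occCount_empty _ _

theorem Invol.count_singleton (t : Invol) (b : Fin 4) : t.count {b} = t.1 := by
  rw [Invol.count, occCount_singleton, Set.ncard_univ, Nat.card_fin]

section Blocks
variable {k : ℕ} {n : Fin k → ℕ}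

/-- The block of a letter; the letters outside the blocks form blocks of their own. -/
def block (x : BlockWord n) : Fin k ⊕ Fin k :=
  WithBot.recBotCoe (C := fun _ => Fin k ⊕ Fin k) (Sum.inl (ofLex x).1)
    (fun _ => Sum.inr (ofLex x).1) (ofLex x).2

@[simp] theorem block_pt (i : Fin k) : block (pt i : BlockWord n) = Sum.inl i := rfl
@[simp] theorem block_gap (i : Fin k) (a : Fin (n i)) :
    block (gap i a : BlockWord n) = Sum.inr i := rfl

/-- The relative position of a block. -/
def blockPos : Fin k ⊕ Fin k → ℕ := Sum.elim (fun i => 2 * i) (fun i => 2 * i + 1)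

/-- The relative height of a block. -/
def blockVal (C : Fin k → Fin k) : Fin k ⊕ Fin k → ℕ :=
  Sum.elim (fun i => 2 * C i) (fun i => 2 * i + 1)

theorem lt_iff_blockPos (x y : BlockWord n) (h : block x ≠ block y) :
    x < y ↔ blockPos (block x) < blockPos (block y) := by
  induction x using cases_pt_gap with
  | hp i =>
    induction y using cases_pt_gap with
    | hp j => rw [pt_lt_pt]; simp [blockPos]
    | hg j b =>
      rw [pt_lt_gap]
      simp only [blockPos, block_pt, block_gap, Sum.elim_inl, Sum.elim_inr]
      omega
  | hg i a =>
    induction y using cases_pt_gap with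
    | hp j =>
      rw [gap_lt_pt]
      simp only [blockPos, block_pt, block_gap, Sum.elim_inl, Sum.elim_inr]
      omega
    | hg j b =>
      have hij : i ≠ j := fun h' => h (by simp [h'])
      rw [gap_lt_gap hij]; simp [blockPos]

theorem inflate_lt_iff_blockVal {C : Fin k → Fin k} (s : ∀ i, Fin (n i) → Fin (n i))
    (x y : BlockWord n) (h : block x ≠ block y) :
    inflate C s x < inflate C s y ↔ blockVal C (block x) < blockVal C (block y) := by
  induction x using cases_pt_gap with
  | hp i =>
    induction y using cases_pt_gap with
    | hp j => rw [inflate_pt, inflate_pt, pt_lt_pt]; simp [blockVal]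
    | hg j b =>
      rw [inflate_pt, inflate_gap, pt_lt_gap]
      simp only [blockVal, block_pt, block_gap, Sum.elim_inl, Sum.elim_inr]; omega
  | hg i a =>
    induction y using cases_pt_gap with
    | hp j =>
      rw [inflate_pt, inflate_gap, gap_lt_pt]
      simp only [blockVal, block_pt, block_gap, Sum.elim_inl, Sum.elim_inr]; omega
    | hg j b =>
      have hij : i ≠ j := fun h' => h (by simp [h'])
      rw [inflate_gap, inflate_gap, gap_lt_gap hij]; simp [blockVal]

theorem block_preimage_inl (i : Fin k) :
    (block ⁻¹' {Sum.inl i} : Set (BlockWord n)) = Set.range (fun _ : Unit => pt i) := by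
  ext x
  induction x using cases_pt_gap with
  | hp j => simp [pt_injective.eq_iff, eq_comm]
  | hg j b => simpa using pt_ne_gap.symm

theorem block_preimage_inr (i : Fin k) :
    (block ⁻¹' {Sum.inr i} : Set (BlockWord n)) = Set.range (gap i) := by
  ext x
  induction x using cases_pt_gap with
  | hp j => simpa using fun x h => pt_ne_gap h.symm
  | hg j b =>
    simp only [Set.mem_preimage, block_gap, Set.mem_singleton_iff, Sum.inr.injEq, Set.mem_range]
    constructor
    · rintro rfl
      exact ⟨b, rfl⟩
    · rintro ⟨y, hy⟩
      simpa using (congrArg block hy).symm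

theorem occCount_block_inl (C : Fin k → Fin k) (s : ∀ i, Fin (n i) → Fin (n i)) (i : Fin k)
    (B : Finset (Fin 4)) :
    occCount (inflate C s) (block ⁻¹' {Sum.inl i}) B = occCount (id : Unit → Unit) Set.univ B := by
  rw [block_preimage_inl]
  refine occCount_range _ (fun _ _ _ => rfl) (fun x y => ?_) (fun x y => ?_) B
  · simp
  · simp

theorem occCount_block_inr (C : Fin k → Fin k) (s : ∀ i, Fin (n i) → Fin (n i)) (i : Fin k)
    (B : Finset (Fin 4)) :
    occCount (inflate C s) (block ⁻¹' {Sum.inr i}) B = occCount (s i) Set.univ B := by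
  rw [block_preimage_inr]
  refine occCount_range _ (gap_injective i) (fun x y => gap_lt_gap_same) (fun x y => ?_) B
  rw [inflate_gap, inflate_gap, gap_lt_gap_same]

end Blocks

section Assemble
variable {k : ℕ} (C : Conn k) (σ : Fin k → Invol)

theorem count_assemble_eq_occCount (B : Finset (Fin 4)) : (assemble C σ).count B =
    occCount (inflate (n := fun i => (σ i).1) C.1 (fun i => (σ i).2.1)) Set.univ B := by
  obtain ⟨e, he⟩ := assemble_iso C σ
  exact (occCount_congr_equiv e.toEquiv (fun x y => e.lt_iff_lt) (fun x => (he x).symm) B).symm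

open Classical in
theorem count_assemble (B : Finset (Fin 4)) : (assemble C σ).count B =
    ∑ h ∈ Finset.univ.filter (BlockCompat blockPos (blockVal C.1) B),
      ((∏ i, occCount (id : Unit → Unit) Set.univ
          (Finset.univ.filter fun b => h b = some (Sum.inl i))) *
        ∏ i, (σ i).count (Finset.univ.filter fun b => h b = some (Sum.inr i))) := by
  rw [count_assemble_eq_occCount, occCount_eq_sum_blocks _ block blockPos (blockVal C.1)
    lt_iff_blockPos (inflate_lt_iff_blockVal _)]
  refine Finset.sum_congr rfl fun h _ => ?_
  rw [Fintype.prod_sum_type]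
  simp only [occCount_block_inl, occCount_block_inr, Invol.count]
  congr!

/-- The formula of `count_assemble` uses only sums, products and factors depending on `C`, all of
which respect the cap. -/
theorem count_assemble_congr {c : ℕ} {σ' : Fin k → Invol}
    (h : ∀ i B, CapEq c ((σ i).count B) ((σ' i).count B)) (B : Finset (Fin 4)) :
    CapEq c ((assemble C σ).count B) ((assemble C σ').count B) := by
  rw [count_assemble, count_assemble]
  exact CapEq.sum _ fun _ _ => CapEq.mul (Or.inl rfl) (CapEq.prod _ fun i _ => h i _)

theorem count_le_assemble (i : Fin k) (B : Finset (Fin 4)) :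
    (σ i).count B ≤ (assemble C σ).count B := by
  rw [count_assemble_eq_occCount, Invol.count, ← occCount_block_inr C.1 (fun i => (σ i).2.1)]
  exact occCount_mono _ (Set.subset_univ _) B

theorem count_add_le_assemble {i j : Fin k} (hij : i ≠ j) {B : Finset (Fin 4)}
    (hB : B.Nonempty) : (σ i).count B + (σ j).count B ≤ (assemble C σ).count B := by
  rw [count_assemble_eq_occCount, Invol.count, Invol.count,
    ← occCount_block_inr C.1 (fun i => (σ i).2.1), ← occCount_block_inr C.1 (fun i => (σ i).2.1)]
  refine occCount_add_le _ (Set.disjoint_left.2 fun x hx hx' => hij ?_) hB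
  simp only [Set.mem_preimage, Set.mem_singleton_iff] at hx hx'
  simpa using hx.symm.trans hx'

theorem count_component_add_le_assemble (i : Fin k) {B : Finset (Fin 4)}
    (hB : B.Nonempty) :
    occCount C.1 Set.univ B + (σ i).count B ≤ (assemble C σ).count B := by
  have h : occCount (inflate (n := fun i => (σ i).1) C.1 (fun i => (σ i).2.1)) (Set.range pt) B
      = occCount C.1 Set.univ B :=
    occCount_range _ pt_injective (fun _ _ => pt_lt_pt)
      (fun _ _ => by rw [inflate_pt, inflate_pt, pt_lt_pt]) B
  rw [count_assemble_eq_occCount, Invol.count, ← h,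
    ← occCount_block_inr C.1 (fun i => (σ i).2.1)]
  refine occCount_add_le _ (Set.disjoint_left.2 fun x hx hx' => ?_) hB
  obtain ⟨j, rfl⟩ := hx
  simp at hx'

end Assemble

/-! ### Crossing arcs and the size of a component -/

theorem some_comp_mem_partialOccurrences {α : Type*} [LinearOrder α] {f : α → α} {p : Fin 4 → α}
    (hp : StrictMono p) (hq : StrictMono fun i => f (p (pattern3412 i))) :
    (fun b => some (p b)) ∈ partialOccurrences f Set.univ Finset.univ := by
  refine ⟨by simp, fun _ _ _ => trivial, fun a b x y hx hy => ?_⟩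
  obtain rfl := Option.some.inj hx
  obtain rfl := Option.some.inj hy
  refine ⟨hp.lt_iff_lt, ?_⟩
  have hτ : ∀ a, pattern3412 (pattern3412 a) = a := by decide
  have := hq.lt_iff_lt (a := pattern3412 a) (b := pattern3412 b)
  simpa only [hτ] using this

theorem exists_occurrence_of_crossing {α : Type*} [LinearOrder α] {f : α → α}
    (hf : Function.Involutive f) {a b : α} (h1 : a < b) (h2 : b < f a) (h3 : f a < f b) :
    (fun i => some (![a, b, f a, f b] i)) ∈ partialOccurrences f Set.univ Finset.univ := by
  apply some_comp_mem_partialOccurrences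
  · rw [Fin.strictMono_iff_lt_succ]
    intro i
    fin_cases i <;> assumption
  · rw [Fin.strictMono_iff_lt_succ]
    intro i
    fin_cases i <;> simpa [pattern3412, hf a, hf b]

/-- An arc that crosses another one lies on an occurrence. An arc or fixed point without crossings
cuts the word into invariant pieces, which yields a proper rooted closed set as soon as there are
three letters. -/
theorem exists_occurrence_through {k : ℕ} (C : Conn k) (hk : 3 ≤ k) (x : Fin k) :
    ∃ g ∈ partialOccurrences C.1 Set.univ Finset.univ, ∃ b, g b = some x := by
  obtain ⟨C, hC, hk0, hconn⟩ := C
  obtain ⟨a, b, hab, hCa, hCb, hx⟩ : ∃ a b, a ≤ b ∧ C a = b ∧ C b = a ∧ (x = a ∨ x = b) := by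
    rcases le_total x (C x) with h | h
    · exact ⟨x, C x, h, rfl, hC x, Or.inl rfl⟩
    · exact ⟨C x, x, h, hC x, rfl, Or.inr rfl⟩
  by_cases hcr : ∃ y, a < y ∧ y < b ∧ (C y < a ∨ b < C y)
  · obtain ⟨y, hay, hyb, h | h⟩ := hcr
    · refine ⟨_, exists_occurrence_of_crossing hC h (by rwa [hC y]) (by rwa [hC y, hCa]), ?_⟩
      rcases hx with rfl | rfl
      · exact ⟨1, rfl⟩
      · exact ⟨3, by simp [hCa]⟩
    · refine ⟨_, exists_occurrence_of_crossing hC hay (by rwa [hCa]) (by rwa [hCa]), ?_⟩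
      rcases hx with rfl | rfl
      · exact ⟨0, rfl⟩
      · exact ⟨2, by simp [hCa]⟩
  · exfalso
    have hin : ∀ y, a < y → y < b → a < C y ∧ C y < b := by
      intro y h1 h2
      have h3 : ¬ (C y < a ∨ b < C y) := fun h => hcr ⟨y, h1, h2, h⟩
      push Not at h3
      refine ⟨lt_of_le_of_ne h3.1 fun h => ?_, lt_of_le_of_ne h3.2 fun h => ?_⟩
      · have := hC y
        rw [← h, hCa] at this
        exact h2.ne' this
      · have := hC y
        rw [h, hCb] at this
        exact h1.ne this
    have hin' : ∀ y, a ≤ y → y ≤ b → a ≤ C y ∧ C y ≤ b := by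
      intro y h1 h2
      rcases h1.eq_or_lt with rfl | h1
      · rw [hCa]; exact ⟨hab, le_rfl⟩
      rcases h2.eq_or_lt with rfl | h2
      · rw [hCb]; exact ⟨le_rfl, hab⟩
      exact ⟨(hin y h1 h2).1.le, (hin y h1 h2).2.le⟩
    have hzero : ∀ z : Fin k, ⟨0, hk0⟩ ≤ z := fun z => Fin.mk_le_of_le_val (Nat.zero_le _)
    by_cases ha : a = ⟨0, hk0⟩
    -- If the arc starts at the first letter, both the complement of its interior and the segment up
    -- to `b` are rooted closed. So the interior is empty and `b` is the last letter, which
    -- contradicts `3 ≤ k`.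
    · have h1 : {z | ¬ (a < z ∧ z < b)} = Set.univ := by
        refine hconn _ ⟨fun z hz h => hz ?_, fun z hz y hy => ?_, ⟨⟨0, hk0⟩, ?_, hzero⟩⟩
        · have := hin _ h.1 h.2
          rwa [hC] at this
        · simp only [Set.mem_ofPred_eq, not_not] at hz hy
          have := hin z hz.1 hz.2
          omega
        · simp [ha]
      have h2 : {z | z ≤ b} = Set.univ := by
        have h0 : ∀ z, a ≤ z := fun z => ha ▸ hzero z
        refine hconn _ ⟨fun z hz => (hin' z (h0 z) hz).2, fun z hz y hy => ?_,
          ⟨⟨0, hk0⟩, hzero b, hzero⟩⟩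
        simp only [Set.mem_ofPred_eq, not_le] at hz hy
        have : b < C z := by
          by_contra! h
          have := (hin' _ (h0 _) h).2
          rw [hC] at this
          omega
        omega
      have h3 : (⟨k - 1, by omega⟩ : Fin k) ∈ {z | z ≤ b} := h2 ▸ Set.mem_univ _
      change _ ≤ b at h3
      have h4 : (⟨1, by omega⟩ : Fin k) ∈ {z | ¬ (a < z ∧ z < b)} := h1 ▸ Set.mem_univ _
      apply h4
      subst ha
      rw [Fin.le_def] at h3
      rw [Fin.lt_def, Fin.lt_def]
      simp only at h3 ⊢
      omega
    -- Otherwise the complement of the whole arc is rooted closed and misses `a`.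
    · have h1 : {z | ¬ (a ≤ z ∧ z ≤ b)} = Set.univ := by
        refine hconn _ ⟨fun z hz h => hz ?_, fun z hz y hy => ?_, ⟨⟨0, hk0⟩, ?_, hzero⟩⟩
        · have := hin' _ h.1 h.2
          rwa [hC] at this
        · simp only [Set.mem_ofPred_eq, not_not] at hz hy
          have := hin' z hz.1 hz.2
          omega
        · exact fun h => ha (le_antisymm h.1 (hzero a))
      exact (h1 ▸ Set.mem_univ a : a ∈ {z | ¬ (a ≤ z ∧ z ≤ b)}) ⟨le_rfl, hab⟩

/-- Each occurrence covers four letters, and together the occurrences cover them all. -/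
theorem Conn.le_four_mul_occCount {k : ℕ} (C : Conn k) (hk : 3 ≤ k) :
    k ≤ 4 * occCount C.1 Set.univ Finset.univ := by
  set O := partialOccurrences C.1 Set.univ Finset.univ
  have h : Function.Surjective fun p : O × Fin 4 => (p.1.1 p.2).get ((p.1.2.1 p.2).2 (by simp)) := by
    intro x
    obtain ⟨g, hg, b, hb⟩ := exists_occurrence_through C hk x
    exact ⟨(⟨g, hg⟩, b), by simp [hb]⟩
  have := Nat.card_le_card_of_surjective _ h
  rw [Nat.card_prod, Nat.card_fin, Nat.card_fin, Nat.card_coe_set_eq] at this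
  have hO : occCount C.1 Set.univ Finset.univ = O.ncard := rfl
  omega

theorem Conn.eq_swap (C : Conn 2) : C.1 = ![1, 0] := by
  obtain ⟨C, hC, -, hconn⟩ := C
  have h : ∀ D : Fin 2 → Fin 2, Function.Involutive D → D = id ∨ D = ![1, 0] := by
    unfold Function.Involutive
    decide
  rcases h C hC with rfl | rfl
  · exfalso
    have : ({0} : Set (Fin 2)) = Set.univ :=
      hconn _ ⟨fun x hx => hx, fun x _ y _ => Iff.rfl, ⟨0, rfl, fun z => Fin.zero_le z⟩⟩
    have h1 : (1 : Fin 2) ∈ ({0} : Set (Fin 2)) := this ▸ Set.mem_univ _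
    simp at h1
  · rfl

/-! ### Components with one or two letters -/

/-- The letters of a full occurrence of `3412`, in a word with at most two letters outside the
blocks, lie in a single block. -/
theorem exists_eq_inr_of_pattern {k : ℕ} (C : Conn k) (hk : k ≤ 2) (H : Fin 4 → Fin k ⊕ Fin k)
    (h1 : ∀ a b, H a ≠ H b → (blockPos (H a) < blockPos (H b) ↔ a < b) ∧
      (blockVal C.1 (H a) < blockVal C.1 (H b) ↔ pattern3412 a < pattern3412 b))
    (h2 : ∀ a b i, a ≠ b → H a = H b → H a ≠ Sum.inl i) : ∃ j, ∀ b, H b = Sum.inr j := by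
  have hk0 := C.2.2.1
  obtain rfl | rfl : k = 1 ∨ k = 2 := by omega
  · have hC : C.1 = ![0] := Subsingleton.elim _ _
    rw [hC] at h1
    revert H
    decide +kernel
  · rw [C.eq_swap] at h1
    revert H
    decide +kernel

theorem count_assemble_univ_eq_zero {k : ℕ} (C : Conn k) (hk : k ≤ 2) (σ : Fin k → Invol)
    (h : ∀ i, (σ i).count Finset.univ = 0) : (assemble C σ).count Finset.univ = 0 := by
  by_contra hne
  rw [count_assemble_eq_occCount, occCount, Set.ncard_eq_zero, ← ne_eq,
    ← Set.nonempty_iff_ne_empty] at hne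
  obtain ⟨g, hg1, -, hg3⟩ := hne
  choose p hp using fun b => Option.isSome_iff_exists.1 ((hg1 b).2 (Finset.mem_univ b))
  have hlt := fun a b => hg3 a b _ _ (hp a) (hp b)
  obtain ⟨j, hj⟩ := exists_eq_inr_of_pattern C hk (fun b => block (p b))
    (fun a b hab => by
      rw [← lt_iff_blockPos _ _ hab, ← inflate_lt_iff_blockVal (fun i => (σ i).2.1) _ _ hab]
      exact hlt a b)
    (fun a b i hab hH hi => by
      have ha : p a ∈ block ⁻¹' {Sum.inl i} := hi
      have hb : p b ∈ block ⁻¹' {Sum.inl i} := hH.symm.trans hi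
      rw [block_preimage_inl] at ha hb
      obtain ⟨_, ha⟩ := ha
      obtain ⟨_, hb⟩ := hb
      have hab' : p a = p b := ha.symm.trans hb
      rcases lt_or_gt_of_ne hab with h' | h'
      · exact ((hlt a b).1.2 h').ne hab'
      · exact ((hlt b a).1.2 h').ne hab'.symm)
  have hz := h j
  rw [Invol.count, ← occCount_block_inr C.1 (fun i => (σ i).2.1), occCount,
    Set.ncard_eq_zero] at hz
  refine Set.eq_empty_iff_forall_notMem.1 hz g ⟨hg1, fun b x hx => ?_, hg3⟩
  rw [hp b] at hx
  obtain rfl := Option.some.inj hx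
  exact hj b

/-- One distribution `h` contributes one summand to `count_assemble`; the component letters
contribute the factor 1 because each carries at most one letter of the pattern. -/
theorem prod_le_count_assemble_two (C : Conn 2) (σ : Fin 2 → Invol) {B : Finset (Fin 4)}
    (h : Fin 4 → Option (Fin 2 ⊕ Fin 2)) (hc : BlockCompat blockPos (blockVal ![1, 0]) B h)
    (h0 : (Finset.univ.filter fun b => h b = some (Sum.inl 0)).card ≤ 1)
    (h1 : (Finset.univ.filter fun b => h b = some (Sum.inl 1)).card ≤ 1) :
    (σ 0).count (Finset.univ.filter fun b => h b = some (Sum.inr 0)) *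
      (σ 1).count (Finset.univ.filter fun b => h b = some (Sum.inr 1)) ≤
    (assemble C σ).count B := by
  classical
  have hone : ∀ S : Finset (Fin 4), S.card ≤ 1 → occCount (id : Unit → Unit) Set.univ S = 1 := by
    intro S hS
    rcases Finset.card_le_one_iff_subset_singleton.1 hS with ⟨b, hb⟩
    rcases Finset.subset_singleton_iff.1 hb with rfl | rfl
    · exact occCount_empty _ _
    · rw [occCount_singleton]
      simp
  rw [count_assemble, C.eq_swap]
  refine le_trans (le_of_eq ?_) (Finset.single_le_sum (fun _ _ => Nat.zero_le _)
    (Finset.mem_filter.2 ⟨Finset.mem_univ h, hc⟩))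
  rw [Fin.prod_univ_two, Fin.prod_univ_two, hone _ h0, hone _ h1]
  simp

/-- If both blocks below an arc have the same capped numbers of partial occurrences as the whole
word, then all numbers of proper partial occurrences reach the cap. -/
theorem cap_le_count_assemble_two {c : ℕ} (C : Conn 2) (σ : Fin 2 → Invol)
    (h : ∀ i B, B.Nonempty → CapEq c ((σ i).count B) ((assemble C σ).count B))
    (B : Finset (Fin 4)) (hB : B.Nonempty) (hB' : B ≠ Finset.univ) :
    c ≤ (assemble C σ).count B := by
  -- For singletons the count is the size. The word is longer than either block, so capped equality
  -- can only mean that both sizes reach the cap.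
  have hsize : ∀ i, c ≤ (σ i).1 := by
    intro i
    have h1 := h i {0} (Finset.singleton_nonempty _)
    rw [Invol.count_singleton, Invol.count_singleton, assemble_size, Fin.sum_univ_two] at h1
    rcases h1 with h1 | h1
    · fin_cases i <;> simp at h1 <;> omega
    · exact h1.1
  have hmul : c ≤ (σ 0).1 * (σ 1).1 := by
    rcases Nat.eq_zero_or_pos c with rfl | hc
    · exact Nat.zero_le _
    · exact (hsize 0).trans (Nat.le_mul_of_pos_right _ (hc.trans_le (hsize 1)))
  have key : ∀ B g S₀ S₁, BlockCompat blockPos (blockVal ![1, 0]) B g →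
      (Finset.univ.filter fun b => g b = some (Sum.inl 0)).card ≤ 1 →
      (Finset.univ.filter fun b => g b = some (Sum.inl 1)).card ≤ 1 →
      (Finset.univ.filter fun b => g b = some (Sum.inr 0)) = S₀ →
      (Finset.univ.filter fun b => g b = some (Sum.inr 1)) = S₁ →
      c ≤ (σ 0).count S₀ * (σ 1).count S₁ → c ≤ (assemble C σ).count B := by
    rintro B g _ _ hg h0 h1 rfl rfl hle
    exact hle.trans (prod_le_count_assemble_two C σ g hg h0 h1)
  have hback : ∀ B, B.Nonempty → c ≤ (assemble C σ).count B →
      c ≤ (σ 0).count B * (σ 1).count ∅ := by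
    intro B hB hle
    rw [Invol.count_empty, mul_one]
    rcases h 0 B hB with h1 | h1
    · rwa [h1]
    · exact h1.1
  have hsize0 : ∀ b, c ≤ (σ 0).count {b} * (σ 1).count ∅ := fun b => by
    rw [Invol.count_empty, mul_one, Invol.count_singleton]
    exact hsize 0
  have hpair : ∀ a b, c ≤ (σ 0).count {a} * (σ 1).count {b} := fun a b => by
    rwa [Invol.count_singleton, Invol.count_singleton]
  -- The block under the arc lies before and below the block after it, so an ascending pair can be
  -- split between the two.
  have h01 : c ≤ (assemble C σ).count {0, 1} :=
    key _ ![some (Sum.inr 0), some (Sum.inr 1), none, none] {0} {1}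
      (by unfold BlockCompat; decide) (by decide) (by decide) (by decide) (by decide) (hpair _ _)
  have h23 : c ≤ (assemble C σ).count {2, 3} :=
    key _ ![none, none, some (Sum.inr 0), some (Sum.inr 1)] {2} {3}
      (by unfold BlockCompat; decide) (by decide) (by decide) (by decide) (by decide) (hpair _ _)
  have hcases : ∀ B : Finset (Fin 4), B.Nonempty → B ≠ Finset.univ → (∃ b, B = {b}) ∨
      B = {0, 1} ∨ B = {2, 3} ∨ B = {0, 2} ∨ B = {0, 3} ∨ B = {1, 2} ∨ B = {1, 3} ∨
      B = {0, 2, 3} ∨ B = {1, 2, 3} ∨ B = {0, 1, 2} ∨ B = {0, 1, 3} := by decide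
  rcases hcases B hB hB' with ⟨b, rfl⟩ | rfl | rfl | rfl | rfl | rfl | rfl | rfl | rfl | rfl | rfl
  · rw [Invol.count_singleton, assemble_size, Fin.sum_univ_two]
    have := hsize 0
    omega
  · exact h01
  · exact h23
  -- The left end of the arc precedes the block under it and has a larger value, so it can play 3 or
  -- 4 against letters 1 and 2 in that block.
  · exact key _ ![some (Sum.inl 0), none, some (Sum.inr 0), none] {2} ∅
      (by unfold BlockCompat; decide) (by decide) (by decide) (by decide) (by decide) (hsize0 _)
  · exact key _ ![some (Sum.inl 0), none, none, some (Sum.inr 0)] {3} ∅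
      (by unfold BlockCompat; decide) (by decide) (by decide) (by decide) (by decide) (hsize0 _)
  · exact key _ ![none, some (Sum.inl 0), some (Sum.inr 0), none] {2} ∅
      (by unfold BlockCompat; decide) (by decide) (by decide) (by decide) (by decide) (hsize0 _)
  · exact key _ ![none, some (Sum.inl 0), none, some (Sum.inr 0)] {3} ∅
      (by unfold BlockCompat; decide) (by decide) (by decide) (by decide) (by decide) (hsize0 _)
  · exact key _ ![some (Sum.inl 0), none, some (Sum.inr 0), some (Sum.inr 0)] {2, 3} ∅
      (by unfold BlockCompat; decide) (by decide) (by decide) (by decide) (by decide)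
      (hback _ (by simp) h23)
  · exact key _ ![none, some (Sum.inl 0), some (Sum.inr 0), some (Sum.inr 0)] {2, 3} ∅
      (by unfold BlockCompat; decide) (by decide) (by decide) (by decide) (by decide)
      (hback _ (by simp) h23)
  -- Symmetrically, the right end of the arc plays 1 or 2 after the pair 34 in the block.
  · exact key _ ![some (Sum.inr 0), some (Sum.inr 0), some (Sum.inl 1), none] {0, 1} ∅
      (by unfold BlockCompat; decide) (by decide) (by decide) (by decide) (by decide)
      (hback _ (by simp) h01)
  · exact key _ ![some (Sum.inr 0), some (Sum.inr 0), none, some (Sum.inl 1)] {0, 1} ∅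
      (by unfold BlockCompat; decide) (by decide) (by decide) (by decide) (by decide)
      (hback _ (by simp) h01)

/-! ### Generating functions of combinatorial classes -/

/-- The generating function of a class of objects with respect to a size. -/
noncomputable def sizeSeries {A : Type*} (sz : A → ℕ) : ℚ⟦X⟧ :=
  PowerSeries.mk fun n => (Nat.card {a // sz a = n} : ℚ)

theorem coeff_sizeSeries {A : Type*} (sz : A → ℕ) (n : ℕ) :
    PowerSeries.coeff n (sizeSeries sz) = (Nat.card {a // sz a = n} : ℚ) :=
  PowerSeries.coeff_mk _ _

theorem sizeSeries_congr {A B : Type*} {sz : A → ℕ} {sz' : B → ℕ} (e : A ≃ B)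
    (h : ∀ a, sz' (e a) = sz a) : sizeSeries sz = sizeSeries sz' := by
  ext n
  rw [coeff_sizeSeries, coeff_sizeSeries]
  congr 1
  exact Nat.card_congr (e.subtypeEquiv fun a => by rw [h])

theorem sizeSeries_of_isEmpty {A : Type*} [IsEmpty A] (sz : A → ℕ) : sizeSeries sz = 0 := by
  ext n
  rw [coeff_sizeSeries]
  simp

/-- There are finitely many objects of each size. -/
def FiniteFibers {A : Type*} (sz : A → ℕ) : Prop := ∀ n, Finite {a // sz a = n}

theorem FiniteFibers.of_injective {A B : Type*} {sz : A → ℕ} {sz' : B → ℕ}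
    (h : FiniteFibers sz') (u : A → B) (hu : Function.Injective u)
    (hsz : ∀ a, sz' (u a) = sz a) : FiniteFibers sz := by
  intro n
  have := h n
  exact Finite.of_injective (fun a : {a // sz a = n} =>
    (⟨u a.1, (hsz a.1).trans a.2⟩ : {b // sz' b = n}))
    fun a b hab => Subtype.ext (hu (congrArg Subtype.val hab))

theorem sizeSeries_sigma {ι : Type*} [Fintype ι] {A : ι → Type*} {sz : ∀ i, A i → ℕ}
    (h : ∀ i, FiniteFibers (sz i)) :
    sizeSeries (fun p : Σ i, A i => sz p.1 p.2) = ∑ i, sizeSeries (sz i) := by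
  ext n
  rw [map_sum, coeff_sizeSeries]
  simp only [coeff_sizeSeries]
  have e : {p : Σ i, A i // sz p.1 p.2 = n} ≃ Σ i, {a // sz i a = n} :=
    { toFun := fun p => ⟨p.1.1, p.1.2, p.2⟩
      invFun := fun p => ⟨⟨p.1, p.2.1⟩, p.2.2⟩
      left_inv := fun _ => rfl
      right_inv := fun _ => rfl }
  have := fun i => h i n
  rw [Nat.card_congr e, Nat.card_sigma, Nat.cast_sum]

theorem FiniteFibers.sigma {ι : Type*} [Finite ι] {A : ι → Type*} {sz : ∀ i, A i → ℕ}
    (h : ∀ i, FiniteFibers (sz i)) : FiniteFibers (fun p : Σ i, A i => sz p.1 p.2) := by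
  intro n
  have := fun i => h i n
  refine Finite.of_injective (fun p : {p : Σ i, A i // sz p.1 p.2 = n} =>
    (⟨p.1.1, p.1.2, p.2⟩ : Σ i, {a // sz i a = n})) ?_
  exact Function.LeftInverse.injective (g := fun p => ⟨⟨p.1, p.2.1⟩, p.2.2⟩) fun _ => rfl

theorem sizeSeries_eq_sum_fibers {A ι : Type*} [Fintype ι] {sz : A → ℕ} (h : FiniteFibers sz)
    (φ : A → ι) : sizeSeries sz = ∑ i, sizeSeries (fun a : {a // φ a = i} => sz a.1) := by
  rw [← sizeSeries_sigma fun i => h.of_injective _ Subtype.val_injective fun _ => rfl]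
  exact sizeSeries_congr (Equiv.sigmaFiberEquiv φ).symm fun _ => rfl

theorem sizeSeries_prod {A B : Type*} {sz : A → ℕ} {sz' : B → ℕ} (h : FiniteFibers sz)
    (h' : FiniteFibers sz') :
    sizeSeries (fun p : A × B => sz p.1 + sz' p.2) = sizeSeries sz * sizeSeries sz' := by
  ext n
  rw [PowerSeries.coeff_mul, coeff_sizeSeries]
  simp only [coeff_sizeSeries]
  have e : {p : A × B // sz p.1 + sz' p.2 = n} ≃
      Σ q : Finset.HasAntidiagonal.antidiagonal n, {a // sz a = q.1.1} × {b // sz' b = q.1.2} :=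
    { toFun := fun p => ⟨⟨(sz p.1.1, sz' p.1.2), by simp [p.2]⟩, ⟨p.1.1, rfl⟩, ⟨p.1.2, rfl⟩⟩
      invFun := fun q => ⟨(q.2.1.1, q.2.2.1), by
        rw [q.2.1.2, q.2.2.2]; exact Finset.HasAntidiagonal.mem_antidiagonal.1 q.1.2⟩
      left_inv := fun _ => rfl
      right_inv := by
        rintro ⟨⟨⟨i, j⟩, hq⟩, ⟨a, ha⟩, ⟨b, hb⟩⟩
        dsimp only at ha hb
        subst ha hb
        rfl }
  have hfin : ∀ q : Finset.HasAntidiagonal.antidiagonal n,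
      Finite ({a // sz a = q.1.1} × {b // sz' b = q.1.2}) := fun q => by
    have := h q.1.1
    have := h' q.1.2
    infer_instance
  rw [Nat.card_congr e, Nat.card_sigma, Nat.cast_sum,
    ← Finset.sum_coe_sort (Finset.HasAntidiagonal.antidiagonal n)]
  simp [Nat.card_prod]

theorem FiniteFibers.prod {A B : Type*} {sz : A → ℕ} {sz' : B → ℕ} (h : FiniteFibers sz)
    (h' : FiniteFibers sz') : FiniteFibers (fun p : A × B => sz p.1 + sz' p.2) := by
  intro n
  have hfin : ∀ q : Finset.HasAntidiagonal.antidiagonal n,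
      Finite ({a // sz a = q.1.1} × {b // sz' b = q.1.2}) := fun q => by
    have := h q.1.1
    have := h' q.1.2
    infer_instance
  refine Finite.of_injective (fun p : {p : A × B // sz p.1 + sz' p.2 = n} =>
    (⟨⟨(sz p.1.1, sz' p.1.2), by simp [p.2]⟩, ⟨p.1.1, rfl⟩, ⟨p.1.2, rfl⟩⟩ :
      Σ q : Finset.HasAntidiagonal.antidiagonal n, {a // sz a = q.1.1} × {b // sz' b = q.1.2})) ?_
  refine Function.LeftInverse.injective (g := fun q => ⟨(q.2.1.1, q.2.2.1), by
        dsimp only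
        rw [q.2.1.2, q.2.2.2]; exact Finset.HasAntidiagonal.mem_antidiagonal.1 q.1.2⟩) fun _ => rfl

theorem sizeSeries_pi_aux {k : ℕ} : ∀ {A : Fin k → Type} (sz : ∀ i, A i → ℕ)
    (_ : ∀ i, FiniteFibers (sz i)),
    sizeSeries (fun a : ∀ i, A i => ∑ i, sz i (a i)) = ∏ i, sizeSeries (sz i) ∧
      FiniteFibers (fun a : ∀ i, A i => ∑ i, sz i (a i)) := by
  induction k with
  | zero =>
    intro A sz h
    constructor
    · ext n
      rw [coeff_sizeSeries]
      simp only [Finset.univ_eq_empty, Finset.sum_empty, Finset.prod_empty, PowerSeries.coeff_one]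
      by_cases hn : n = 0
      · subst hn
        simp
      · simp [hn, Ne.symm hn]
    · intro n
      infer_instance
  | succ k ih =>
    intro A sz h
    obtain ⟨h1, h2⟩ := ih (fun i : Fin k => sz i.succ) fun i => h _
    have hsz : ∀ a : ∀ i, A i, sz 0 ((Fin.consEquiv A).symm a).1
        + ∑ i : Fin k, sz i.succ (((Fin.consEquiv A).symm a).2 i) = ∑ i, sz i (a i) := by
      intro a
      rw [Fin.sum_univ_succ]
      rfl
    constructor
    · rw [Fin.prod_univ_succ, ← h1, ← sizeSeries_prod (h 0) h2]
      exact sizeSeries_congr (Fin.consEquiv A).symm hsz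
    · exact ((h 0).prod h2).of_injective (Fin.consEquiv A).symm (Equiv.injective _) hsz

theorem sizeSeries_pi {k : ℕ} {A : Fin k → Type} (sz : ∀ i, A i → ℕ)
    (h : ∀ i, FiniteFibers (sz i)) :
    sizeSeries (fun a : ∀ i, A i => ∑ i, sz i (a i)) = ∏ i, sizeSeries (sz i) :=
  (sizeSeries_pi_aux sz h).1

theorem sizeSeries_add_const {A : Type*} (k : ℕ) (sz : A → ℕ) :
    sizeSeries (fun a => k + sz a) = PowerSeries.X ^ k * sizeSeries sz := by
  ext n
  rw [PowerSeries.coeff_X_pow_mul', coeff_sizeSeries]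
  split_ifs with h
  · rw [coeff_sizeSeries]
    congr 1
    exact Nat.card_congr (Equiv.subtypeEquivRight fun a => by omega)
  · have : IsEmpty {a // k + sz a = n} := ⟨fun a => h (by have := a.2; omega)⟩
    simp

theorem finiteFibers_invol : FiniteFibers (fun t : Invol => t.1) := by
  intro n
  refine Finite.of_injective (β := {f : Fin n → Fin n // Function.Involutive f})
    (fun t => t.2 ▸ t.1.2) ?_
  rintro ⟨⟨_, f⟩, rfl⟩ ⟨⟨m, g⟩, hm⟩ h
  dsimp only at hm
  subst hm
  exact Subtype.ext (congrArg (Sigma.mk m) h)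

/-- The generating function of a set of involutions. -/
noncomputable def involSeries (S : Set Invol) : ℚ⟦X⟧ := sizeSeries (fun t : S => t.1.1)

theorem finiteFibers_subtype (S : Set Invol) : FiniteFibers (fun t : S => t.1.1) :=
  finiteFibers_invol.of_injective Subtype.val Subtype.val_injective fun _ => rfl

/-- The words with a given component of the first letter. -/
noncomputable def assembleSeries {k : ℕ} (C : Conn k) (S : Set Invol) : ℚ⟦X⟧ :=
  sizeSeries (fun σ : {σ : Fin k → Invol // assemble C σ ∈ S} => (assemble C σ.1).1)

theorem sizeSeries_forall_mem {k : ℕ} (C : Conn k) (S : Fin k → Set Invol) :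
    sizeSeries (fun σ : {σ : Fin k → Invol // ∀ i, σ i ∈ S i} => (assemble C σ.1).1)
      = PowerSeries.X ^ k * ∏ i, involSeries (S i) := by
  simp only [assemble_size, involSeries]
  rw [sizeSeries_add_const, ← sizeSeries_pi _ fun i => finiteFibers_subtype _]
  congr 1
  exact sizeSeries_congr (Equiv.subtypePiEquivPi (p := fun i t => t ∈ S i)) fun _ => rfl

theorem finiteFibers_assemble {k : ℕ} (C : Conn k) (P : (Fin k → Invol) → Prop) :
    FiniteFibers (fun σ : {σ : Fin k → Invol // P σ} => (assemble C σ.1).1) :=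
  finiteFibers_invol.of_injective (fun σ => assemble C σ.1)
    (fun σ τ h => by
      have := assemble_injective h
      simp only [Sigma.mk.injEq, heq_eq_eq, Prod.mk.injEq, true_and] at this
      exact Subtype.ext this) fun _ => rfl

noncomputable instance (k : ℕ) : Fintype (Conn k) := Fintype.ofFinite _

theorem involSeries_eq_sum_assemble (S : Set Invol) (N : ℕ)
    (hN : ∀ k (C : Conn k) σ, assemble C σ ∈ S → k < N) :
    involSeries S = involSeries {t ∈ S | t.1 = 0} +
      ∑ k : Fin N, ∑ C : Conn k, assembleSeries C S := by
  classical
  have h1 : involSeries S = involSeries {t ∈ S | t.1 = 0} + involSeries {t ∈ S | 0 < t.1} := by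
    rw [involSeries, sizeSeries_eq_sum_fibers (finiteFibers_subtype S)
      (fun t => decide (t.1.1 = 0)), Fintype.sum_bool]
    congr 1
    · exact sizeSeries_congr
        (B := {t : Invol | t ∈ S ∧ t.1 = 0})
        { toFun := fun t => ⟨t.1.1, t.1.2, by simpa using t.2⟩
          invFun := fun t => ⟨⟨t.1, t.2.1⟩, by simpa using t.2.2⟩
          left_inv := fun _ => rfl
          right_inv := fun _ => rfl } fun _ => rfl
    · exact sizeSeries_congr
        (B := {t : Invol | t ∈ S ∧ 0 < t.1})
        { toFun := fun t => ⟨t.1.1, t.1.2, Nat.pos_of_ne_zero (by simpa using t.2)⟩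
          invFun := fun t => ⟨⟨t.1, t.2.1⟩, by simpa using t.2.2.ne'⟩
          left_inv := fun _ => rfl
          right_inv := fun _ => rfl } fun _ => rfl
  have h2 : involSeries {t ∈ S | 0 < t.1} = ∑ k : Fin N, ∑ C : Conn k, assembleSeries C S := by
    simp only [assembleSeries]
    simp_rw [← sizeSeries_sigma fun C : Conn _ => finiteFibers_assemble C _]
    rw [← sizeSeries_sigma fun k => ?_]
    · symm
      have hpos : ∀ k (C : Conn k) σ, 0 < (assemble C σ).1 := fun k C σ => by
        rw [assemble_size]
        exact Nat.add_pos_left C.2.2.1 _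
      let u : (Σ k : Fin N, Σ C : Conn k, {σ : Fin k → Invol // assemble C σ ∈ S}) →
          {t : Invol | t ∈ S ∧ 0 < t.1} := fun p =>
        ⟨assemble p.2.1 p.2.2.1, p.2.2.2, hpos _ _ _⟩
      have hu : Function.Bijective u := by
        constructor
        · rintro ⟨⟨k, hk⟩, C, σ, hσ⟩ ⟨⟨k', hk'⟩, C', σ', hσ'⟩ h
          have := assemble_injective (congrArg Subtype.val h)
          cases this
          rfl
        · rintro ⟨t, ht, ht'⟩
          obtain ⟨k, C, σ, rfl⟩ := exists_assemble t ht'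
          exact ⟨⟨⟨k, hN k C σ ht⟩, C, σ, ht⟩, rfl⟩
      exact sizeSeries_congr (Equiv.ofBijective u hu) fun _ => rfl
    · exact FiniteFibers.sigma fun C : Conn _ => finiteFibers_assemble C _
  rw [h1, h2]

/-! ### The field generated by the variable and the square root -/

/-- The rational functions of `x` and `√(1 - 2x - 3x²)`. -/
noncomputable def sqrtField : IntermediateField ℚ ℚ⸨X⸩ :=
  IntermediateField.adjoin ℚ
    (Set.range fun i => ((![PowerSeries.X, sqrtSeries] i : ℚ⟦X⟧) : ℚ⸨X⸩))

/-- A power series that is a rational function of `x` and `√(1 - 2x - 3x²)`. -/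
def IsRat (f : ℚ⟦X⟧) : Prop := (f : ℚ⸨X⸩) ∈ sqrtField

theorem IsRat.add {f g : ℚ⟦X⟧} (hf : IsRat f) (hg : IsRat g) : IsRat (f + g) := by
  unfold IsRat
  rw [map_add]
  exact add_mem hf hg

theorem IsRat.sub {f g : ℚ⟦X⟧} (hf : IsRat f) (hg : IsRat g) : IsRat (f - g) := by
  unfold IsRat
  rw [map_sub]
  exact sub_mem hf hg

theorem IsRat.mul {f g : ℚ⟦X⟧} (hf : IsRat f) (hg : IsRat g) : IsRat (f * g) := by
  unfold IsRat
  rw [map_mul]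
  exact mul_mem hf hg

theorem IsRat.pow {f : ℚ⟦X⟧} (hf : IsRat f) (k : ℕ) : IsRat (f ^ k) := by
  unfold IsRat
  rw [map_pow]
  exact pow_mem hf k

theorem isRat_zero : IsRat 0 := by
  unfold IsRat
  rw [map_zero]
  exact zero_mem _

theorem isRat_one : IsRat 1 := by
  unfold IsRat
  rw [map_one]
  exact one_mem _

theorem isRat_natCast (n : ℕ) : IsRat n := by
  unfold IsRat
  rw [map_natCast]
  exact natCast_mem _ n

theorem IsRat.sum {ι : Type*} (s : Finset ι) {f : ι → ℚ⟦X⟧} (h : ∀ i ∈ s, IsRat (f i)) :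
    IsRat (∑ i ∈ s, f i) := by
  unfold IsRat
  rw [map_sum]
  exact sum_mem h

theorem IsRat.prod {ι : Type*} (s : Finset ι) {f : ι → ℚ⟦X⟧} (h : ∀ i ∈ s, IsRat (f i)) :
    IsRat (∏ i ∈ s, f i) := by
  unfold IsRat
  rw [map_prod]
  exact prod_mem h

theorem isRat_X : IsRat PowerSeries.X :=
  IntermediateField.subset_adjoin _ _ ⟨0, rfl⟩

theorem isRat_sqrtSeries : IsRat sqrtSeries :=
  IntermediateField.subset_adjoin _ _ ⟨1, rfl⟩

theorem IsRat.of_mul {f g : ℚ⟦X⟧} (hg : g ≠ 0) (h : IsRat g) (hgf : IsRat (g * f)) : IsRat f := by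
  unfold IsRat at *
  rw [map_mul] at hgf
  have hg' : (g : ℚ⸨X⸩) ≠ 0 := by
    rw [Ne, ← map_zero (HahnSeries.ofPowerSeries ℤ ℚ)]
    exact fun h => hg (HahnSeries.ofPowerSeries_injective h)
  have := mul_mem (inv_mem h) hgf
  rwa [inv_mul_cancel_left₀ hg'] at this

theorem IsRat.exists_eq_div {f : ℚ⟦X⟧} (h : IsRat f) : ∃ P Q : MvPolynomial (Fin 2) ℚ,
    (MvPolynomial.aeval ![PowerSeries.X, sqrtSeries] Q : ℚ⟦X⟧) ≠ 0 ∧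
    (f : ℚ⸨X⸩) = ((MvPolynomial.aeval ![PowerSeries.X, sqrtSeries] P : ℚ⟦X⟧) : ℚ⸨X⸩) /
      ((MvPolynomial.aeval ![PowerSeries.X, sqrtSeries] Q : ℚ⟦X⟧) : ℚ⸨X⸩) := by
  obtain ⟨P, Q, hPQ⟩ := (IntermediateField.mem_adjoin_range_iff ℚ _ _).1 h
  have key : ∀ R : MvPolynomial (Fin 2) ℚ, MvPolynomial.aeval
      (fun i => ((![PowerSeries.X, sqrtSeries] i : ℚ⟦X⟧) : ℚ⸨X⸩)) R
      = ((MvPolynomial.aeval ![PowerSeries.X, sqrtSeries] R : ℚ⟦X⟧) : ℚ⸨X⸩) := by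
    intro R
    exact (MvPolynomial.comp_aeval_apply ![PowerSeries.X, sqrtSeries]
      (HahnSeries.ofPowerSeries ℤ ℚ).toRatAlgHom R).symm
  rw [key, key] at hPQ
  -- Membership in the field gives a quotient whose denominator may evaluate to zero. The quotient
  -- is then zero by convention and is rewritten as `0 / 1`.
  by_cases hQ : (MvPolynomial.aeval ![PowerSeries.X, sqrtSeries] Q : ℚ⟦X⟧) = 0
  · refine ⟨0, 1, by simp, ?_⟩
    rw [hPQ, hQ]
    simp
  · exact ⟨P, Q, hQ, hPQ⟩

/-- `f` is an affine function of `H` over the rational functions of `x` and `√(1 - 2x - 3x²)`, with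
a linear coefficient that vanishes at `0`. -/
def IsAffineIn (H f : ℚ⟦X⟧) : Prop :=
  ∃ a b, IsRat a ∧ IsRat b ∧ PowerSeries.constantCoeff b = 0 ∧ f = a + b * H

theorem IsRat.isAffineIn {f : ℚ⟦X⟧} (h : IsRat f) (H : ℚ⟦X⟧) : IsAffineIn H f :=
  ⟨f, 0, h, isRat_zero, by simp, by simp⟩

theorem isAffineIn_mul {b : ℚ⟦X⟧} (h : IsRat b) (hb : PowerSeries.constantCoeff b = 0)
    (H : ℚ⟦X⟧) : IsAffineIn H (b * H) :=
  ⟨0, b, isRat_zero, h, hb, by simp⟩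

theorem IsAffineIn.add {H f g : ℚ⟦X⟧} (hf : IsAffineIn H f) (hg : IsAffineIn H g) :
    IsAffineIn H (f + g) := by
  obtain ⟨a, b, ha, hb, hb0, rfl⟩ := hf
  obtain ⟨a', b', ha', hb', hb0', rfl⟩ := hg
  exact ⟨a + a', b + b', ha.add ha', hb.add hb', by simp [hb0, hb0'], by ring⟩

theorem IsAffineIn.sum {ι : Type*} {H : ℚ⟦X⟧} (s : Finset ι) {f : ι → ℚ⟦X⟧}
    (h : ∀ i ∈ s, IsAffineIn H (f i)) : IsAffineIn H (∑ i ∈ s, f i) :=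
  Finset.sum_induction f (IsAffineIn H) (fun _ _ => IsAffineIn.add) (isRat_zero.isAffineIn H) h

/-- In `(1 - b) * H = a` the factor `1 - b` has constant term 1, so it is nonzero and can be divided
out. -/
theorem IsAffineIn.isRat {H : ℚ⟦X⟧} (h : IsAffineIn H H) : IsRat H := by
  obtain ⟨a, b, ha, hb, hb0, h⟩ := h
  refine IsRat.of_mul (g := 1 - b) ?_ (isRat_one.sub hb) ?_
  · intro h0
    have := congrArg PowerSeries.constantCoeff h0
    simp [hb0] at this
  · have : (1 - b) * H = a := by linear_combination h
    rwa [this]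

/-! ### Classes of involutions with given capped counts and their equations -/

/-- The numbers of partial occurrences, capped at `r + 1`. -/
noncomputable def capStat (r : ℕ) (t : Invol) (B : Finset (Fin 4)) : Fin (r + 2) :=
  if B = ∅ then Fin.last (r + 1) else ⟨min (t.count B) (r + 1), by omega⟩

theorem capStat_val {r : ℕ} {t : Invol} {B : Finset (Fin 4)} (hB : B.Nonempty) :
    (capStat r t B : ℕ) = min (t.count B) (r + 1) := by
  rw [capStat, if_neg hB.ne_empty]

theorem capEq_of_capStat_eq {r : ℕ} {t t' : Invol} {B : Finset (Fin 4)}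
    (h : capStat r t B = capStat r t' B) : CapEq (r + 1) (t.count B) (t'.count B) := by
  rcases B.eq_empty_or_nonempty with rfl | hB
  · left
    rw [Invol.count_empty, Invol.count_empty]
  · rw [capEq_iff, ← capStat_val hB, ← capStat_val hB, h]

theorem capStat_congr {r : ℕ} {t t' : Invol} {B : Finset (Fin 4)}
    (h : CapEq (r + 1) (t.count B) (t'.count B)) : capStat r t B = capStat r t' B := by
  rcases B.eq_empty_or_nonempty with rfl | hB
  · rfl
  · apply Fin.ext
    rw [capStat_val hB, capStat_val hB, capEq_iff.1 h]

theorem capStat_le {r : ℕ} {t t' : Invol} {B : Finset (Fin 4)} (h : t.count B ≤ t'.count B) :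
    capStat r t B ≤ capStat r t' B := by
  rcases B.eq_empty_or_nonempty with rfl | hB
  · exact le_rfl
  · rw [Fin.le_def, capStat_val hB, capStat_val hB]
    omega

/-- The involutions with given capped numbers of partial occurrences. -/
def capClass (r : ℕ) (v : Finset (Fin 4) → Fin (r + 2)) : Set Invol := {t | capStat r t = v}

theorem count_univ_of_mem_capClass {r : ℕ} {v : Finset (Fin 4) → Fin (r + 2)} {t : Invol}
    (ht : t ∈ capClass r v) (hv : (v Finset.univ : ℕ) ≤ r) :
    t.count Finset.univ = v Finset.univ := by
  have h1 : capStat r t Finset.univ = v Finset.univ := congrFun ht _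
  have h2 := capStat_val (r := r) (t := t) (B := Finset.univ) Finset.univ_nonempty
  rw [h1] at h2
  omega

/-- No occurrence, and as many proper partial occurrences as the cap allows. -/
def topStat (r : ℕ) (B : Finset (Fin 4)) : Fin (r + 2) :=
  if B = Finset.univ then 0 else Fin.last (r + 1)

theorem le_topStat {r : ℕ} {v : Finset (Fin 4) → Fin (r + 2)} (hv : v Finset.univ = 0) :
    v ≤ topStat r := by
  intro B
  rw [topStat]
  split_ifs with h
  · rw [h, hv]
  · exact Fin.le_last _

theorem assembleSeries_eq_sum {k : ℕ} (r : ℕ) (C : Conn k) (S : Set Invol) :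
    assembleSeries C S = ∑ w : Fin k → Finset (Fin 4) → Fin (r + 2),
      sizeSeries (fun σ : {σ : {σ : Fin k → Invol // assemble C σ ∈ S} //
        (fun i => capStat r (σ.1 i)) = w} => (assemble C σ.1.1).1) :=
  sizeSeries_eq_sum_fibers (finiteFibers_assemble C _) _

/-- Whether the assembled word lies in the class depends only on the capped vectors of its blocks.
Hence one witness `σ₀` shows that every choice of blocks from the classes `w i` is admissible, and
the series is a product. -/
theorem sizeSeries_fiber_eq {k r : ℕ} (C : Conn k) (v : Finset (Fin 4) → Fin (r + 2))
    (w : Fin k → Finset (Fin 4) → Fin (r + 2)) (σ₀ : Fin k → Invol)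
    (h : assemble C σ₀ ∈ capClass r v) (h' : ∀ i, σ₀ i ∈ capClass r (w i)) :
    sizeSeries (fun σ : {σ : {σ : Fin k → Invol // assemble C σ ∈ capClass r v} //
        (fun i => capStat r (σ.1 i)) = w} => (assemble C σ.1.1).1)
      = PowerSeries.X ^ k * ∏ i, involSeries (capClass r (w i)) := by
  rw [← sizeSeries_forall_mem C]
  have hmem : ∀ σ : Fin k → Invol, (∀ i, σ i ∈ capClass r (w i)) →
      assemble C σ ∈ capClass r v := by
    intro σ hσ
    rw [← show capStat r (assemble C σ₀) = v from h]
    funext B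
    refine capStat_congr (count_assemble_congr C σ (fun i B => capEq_of_capStat_eq (r := r) ?_) B)
    exact congrFun ((hσ i).trans (h' i).symm) B
  exact sizeSeries_congr
    { toFun := fun σ => ⟨σ.1.1, fun i => congrFun σ.2 i⟩
      invFun := fun σ => ⟨⟨σ.1, hmem σ.1 σ.2⟩, funext fun i => σ.2 i⟩
      left_inv := fun _ => rfl
      right_inv := fun _ => rfl } fun _ => rfl

theorem isRat_involSeries_size_zero (S : Set Invol) : IsRat (involSeries {t ∈ S | t.1 = 0}) := by
  have : involSeries {t ∈ S | t.1 = 0}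
      = ((Nat.card {t : {t | t ∈ S ∧ t.1 = 0} // t.1.1 = 0} : ℕ) : ℚ⟦X⟧) := by
    ext n
    rw [involSeries, coeff_sizeSeries, ← map_natCast PowerSeries.C, PowerSeries.coeff_C]
    split_ifs with hn
    · subst hn
      rfl
    · rw [Nat.cast_eq_zero, Nat.card_eq_zero]
      exact Or.inl ⟨fun t => hn (t.2.symm.trans t.1.2.2)⟩
  rw [this]
  exact isRat_natCast _

/-- Either `k ≤ 2`, or the component alone has at least `k / 4` occurrences; the bound `4 * r + 3`
covers both cases. -/
theorem component_size_lt {k r : ℕ} (C : Conn k) (σ : Fin k → Invol)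
    (h : (assemble C σ).count Finset.univ ≤ r) : k < 4 * r + 3 := by
  by_contra! hk
  have h1 := C.le_four_mul_occCount (by omega)
  have h2 := count_component_add_le_assemble C σ ⟨0, C.2.2.1⟩ (Finset.univ_nonempty (α := Fin 4))
  omega

/-- For `k ≥ 3` the component contains an occurrence, so each block has fewer than the word and lies
in a smaller class. For `k = 1` the product is at most linear in the unknown. For `k = 2` a square
would need both blocks in the class of the word, which is possible only for `topStat r`. -/
theorem isAffineIn_product {k r : ℕ} {v : Finset (Fin 4) → Fin (r + 2)}
    (hv : (v Finset.univ : ℕ) ≤ r) (hne : v ≠ topStat r)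
    (IH : ∀ w < v, IsRat (involSeries (capClass r w))) (C : Conn k)
    (w : Fin k → Finset (Fin 4) → Fin (r + 2)) (σ : Fin k → Invol)
    (h : assemble C σ ∈ capClass r v) (h' : ∀ i, σ i ∈ capClass r (w i)) :
    IsAffineIn (involSeries (capClass r v))
      (PowerSeries.X ^ k * ∏ i, involSeries (capClass r (w i))) := by
  have hle : ∀ i, w i ≤ v := by
    intro i B
    rw [← show capStat r (σ i) = w i from h' i, ← show capStat r (assemble C σ) = v from h]
    exact capStat_le (count_le_assemble C σ i B)
  have hcount := count_univ_of_mem_capClass h hv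
  have hcount' : ∀ i, (σ i).count Finset.univ = w i Finset.univ := fun i =>
    count_univ_of_mem_capClass (h' i) ((Fin.le_def.1 (hle i Finset.univ)).trans hv)
  have hlt_or : ∀ i, w i = v ∨ w i < v := fun i => eq_or_lt_of_le (hle i)
  have hk := C.2.2.1
  by_cases hk3 : 3 ≤ k
  · refine IsRat.isAffineIn ((isRat_X.pow k).mul (IsRat.prod _ fun i _ => IH _ ?_)) _
    refine lt_of_le_of_ne (hle i) fun heq => ?_
    have h1 := C.le_four_mul_occCount hk3
    have h2 := count_component_add_le_assemble C σ i (Finset.univ_nonempty (α := Fin 4))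
    rw [hcount, hcount', heq] at h2
    omega
  · obtain rfl | rfl : k = 1 ∨ k = 2 := by omega
    · rw [Fin.prod_univ_one, pow_one]
      rcases hlt_or 0 with h0 | h0
      · rw [h0]
        exact isAffineIn_mul isRat_X (by simp) _
      · exact (isRat_X.mul (IH _ h0)).isAffineIn _
    · rw [Fin.prod_univ_two]
      rcases hlt_or 0 with h0 | h0
      · rcases hlt_or 1 with h1 | h1
        · exfalso
          apply hne
          have hw : ∀ i, w i = v := fun i => by fin_cases i <;> assumption
          have hstat : ∀ i, capStat r (σ i) = capStat r (assemble C σ) := fun i =>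
            (h' i).trans ((hw i).trans h.symm)
          have hcap := cap_le_count_assemble_two (c := r + 1) C σ
            fun i B _ => capEq_of_capStat_eq (congrFun (hstat i) B)
          -- The occurrences of the two blocks add up, so twice the number of occurrences is at most
          -- that number, which is therefore zero.
          have hsum := count_add_le_assemble C σ (i := 0) (j := 1) (by decide)
            (Finset.univ_nonempty (α := Fin 4))
          rw [hcount, hcount', hcount', h0, h1] at hsum
          funext B
          rw [topStat]
          split_ifs with hB
          · subst hB
            apply Fin.ext
            simp only [Fin.val_zero]
            omega
          · rw [← show capStat r (assemble C σ) = v from h]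
            -- The true count for `∅` is always 1; the value that `capStat` assigns instead is the
            -- one that agrees with `topStat`.
            rcases B.eq_empty_or_nonempty with rfl | hB0
            · rfl
            · apply Fin.ext
              rw [capStat_val hB0, Fin.val_last]
              have := hcap B hB0 hB
              omega
        · rw [h0, show PowerSeries.X ^ 2 * (involSeries (capClass r v) *
            involSeries (capClass r (w 1))) = (PowerSeries.X ^ 2 *
              involSeries (capClass r (w 1))) * involSeries (capClass r v) by ring]
          exact isAffineIn_mul ((isRat_X.pow 2).mul (IH _ h1)) (by simp) _
      · rcases hlt_or 1 with h1 | h1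
        · rw [h1, ← mul_assoc]
          exact isAffineIn_mul ((isRat_X.pow 2).mul (IH _ h0)) (by simp) _
        · exact ((isRat_X.pow 2).mul ((IH _ h0).mul (IH _ h1))).isAffineIn _

theorem isRat_capClass_of_lt {r : ℕ} {v : Finset (Fin 4) → Fin (r + 2)}
    (hv : (v Finset.univ : ℕ) ≤ r) (hne : v ≠ topStat r)
    (IH : ∀ w < v, IsRat (involSeries (capClass r w))) : IsRat (involSeries (capClass r v)) := by
  apply IsAffineIn.isRat
  have := involSeries_eq_sum_assemble (capClass r v) (4 * r + 3) fun k C σ h =>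
    component_size_lt C σ ((count_univ_of_mem_capClass h hv).trans_le hv)
  nth_rw 2 [this]
  refine ((isRat_involSeries_size_zero _).isAffineIn _).add
    (IsAffineIn.sum _ fun k _ => IsAffineIn.sum _ fun C _ => ?_)
  rw [assembleSeries_eq_sum r]
  refine IsAffineIn.sum _ fun w _ => ?_
  by_cases hex : ∃ σ, assemble C σ ∈ capClass r v ∧ ∀ i, σ i ∈ capClass r (w i)
  · obtain ⟨σ, h, h'⟩ := hex
    rw [sizeSeries_fiber_eq C v w σ h h']
    exact isAffineIn_product hv hne IH C w σ h h'
  · have : IsEmpty {σ : {σ : Fin k → Invol // assemble C σ ∈ capClass r v} //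
        (fun i => capStat r (σ.1 i)) = w} :=
      ⟨fun σ => hex ⟨σ.1.1, σ.1.2, fun i => congrFun σ.2 i⟩⟩
    rw [sizeSeries_of_isEmpty]
    exact isRat_zero.isAffineIn _

theorem involSeries_count_eq_sum {r q : ℕ} (hq : q ≤ r) :
    involSeries {t | t.count Finset.univ = q} =
      ∑ v : Finset (Fin 4) → Fin (r + 2) with (v Finset.univ : ℕ) = q,
        involSeries (capClass r v) := by
  rw [involSeries, sizeSeries_eq_sum_fibers (finiteFibers_subtype _) (fun t => capStat r t.1),
    Finset.sum_filter]
  refine Finset.sum_congr rfl fun v _ => ?_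
  have huniv : ∀ t : Invol, t.count Finset.univ = q →
      (capStat r t Finset.univ : ℕ) = q := fun t ht => by
    rw [capStat_val Finset.univ_nonempty, ht]
    omega
  split_ifs with hv
  · exact sizeSeries_congr
      { toFun := fun t => ⟨t.1.1, t.2⟩
        invFun := fun t => ⟨⟨t.1, (count_univ_of_mem_capClass t.2 (hv.trans_le hq)).trans hv⟩, t.2⟩
        left_inv := fun _ => rfl
        right_inv := fun _ => rfl } fun _ => rfl
  · have : IsEmpty {t : {t : Invol | t.count Finset.univ = q} // capStat r t.1 = v} :=
      ⟨fun t => hv (by rw [← t.2]; exact huniv _ t.1.2)⟩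
    exact sizeSeries_of_isEmpty _

/-! ### Involutions without occurrences and the Motzkin equation -/

instance : Nonempty (Conn 1) := by
  refine ⟨id, fun _ => rfl, one_pos, fun K hK => ?_⟩
  obtain ⟨y, hy, -⟩ := hK.bot
  ext z
  simp only [Set.mem_univ, iff_true]
  rwa [Subsingleton.elim z y]

instance : Nonempty (Conn 2) := by
  refine ⟨![1, 0], by unfold Function.Involutive; decide, two_pos, fun K hK => ?_⟩
  obtain ⟨y, hy, -⟩ := hK.bot
  have hy' := hK.map_mem y hy
  ext z
  simp only [Set.mem_univ, iff_true]
  have : z = y ∨ z = ![1, 0] y := by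
    clear hy hy'
    revert z y
    decide
  rcases this with rfl | rfl <;> assumption

/-- Around a fixed point or an arc an occurrence cannot spread over several blocks, so the word
avoids 3412 exactly when all its blocks do. -/
theorem assembleSeries_count_eq_zero {k : ℕ} (hk : k ≤ 2) (C : Conn k) :
    assembleSeries C {t | t.count Finset.univ = 0}
      = (PowerSeries.X * involSeries {t | t.count Finset.univ = 0}) ^ k := by
  have := sizeSeries_forall_mem C fun _ => {t | t.count Finset.univ = 0}
  rw [Finset.prod_const, Finset.card_univ, Fintype.card_fin, ← mul_pow] at this
  rw [← this]
  refine sizeSeries_congr (Equiv.subtypeEquivRight fun σ => ?_) fun _ => rfl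
  constructor
  · intro h i
    have := count_le_assemble C σ i Finset.univ
    exact Nat.le_zero.1 (this.trans_eq h)
  · exact count_assemble_univ_eq_zero C hk σ

theorem involSeries_count_zero_size_zero :
    involSeries {t ∈ {t : Invol | t.count Finset.univ = 0} | t.1 = 0} = 1 := by
  have huniq : ∀ t : Invol, t.1 = 0 → t = ⟨0, id, fun _ => rfl⟩ := by
    rintro ⟨n, f, hf⟩ hn
    dsimp only at hn
    subst hn
    congr 1
    exact Subtype.ext (Subsingleton.elim _ _)
  have hcount : Invol.count ⟨0, id, fun _ => rfl⟩ Finset.univ = 0 := by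
    rw [Invol.count, occCount, Set.ncard_eq_zero]
    refine Set.eq_empty_iff_forall_notMem.2 fun g hg => ?_
    obtain ⟨x, -⟩ := Option.isSome_iff_exists.1 ((hg.1 0).2 (Finset.mem_univ _))
    exact x.elim0
  ext n
  rw [involSeries, coeff_sizeSeries, PowerSeries.coeff_one]
  split_ifs with hn
  · subst hn
    rw [Nat.cast_eq_one, Nat.card_eq_one_iff_exists]
    refine ⟨⟨⟨_, hcount, rfl⟩, rfl⟩, fun t => ?_⟩
    exact Subtype.ext (Subtype.ext (huniq _ t.2))
  · rw [Nat.cast_eq_zero, Nat.card_eq_zero]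
    exact Or.inl ⟨fun t => hn (t.2.symm.trans t.1.2.2)⟩

/-- The involutions without `3412` are counted by the Motzkin numbers. -/
theorem involSeries_count_zero_eq :
    involSeries {t | t.count Finset.univ = 0} =
      1 + PowerSeries.X * involSeries {t | t.count Finset.univ = 0}
        + (PowerSeries.X * involSeries {t | t.count Finset.univ = 0}) ^ 2 := by
  have h := involSeries_eq_sum_assemble {t | t.count Finset.univ = 0} 3
    fun k C σ h => component_size_lt (r := 0) C σ (le_of_eq h)
  rw [involSeries_count_zero_size_zero, Fin.sum_univ_three] at h
  have h0 : IsEmpty (Conn 0) := ⟨fun C => lt_irrefl _ C.2.2.1⟩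
  have : Subsingleton (Conn 1) := ⟨fun C D => Subtype.ext (Subsingleton.elim _ _)⟩
  have : Subsingleton (Conn 2) := ⟨fun C D => Subtype.ext (C.eq_swap.trans D.eq_swap.symm)⟩
  have e0 : ∑ C : Conn ((0 : Fin 3) : ℕ), assembleSeries C {t | t.count Finset.univ = 0} = 0 :=
    Finset.sum_eq_zero fun C _ => h0.elim C
  have e1 : ∑ C : Conn ((1 : Fin 3) : ℕ), assembleSeries C {t | t.count Finset.univ = 0} =
      PowerSeries.X * involSeries {t | t.count Finset.univ = 0} := by
    change ∑ C : Conn 1, assembleSeries C {t | t.count Finset.univ = 0} = _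
    rw [Fintype.sum_subsingleton _ (Classical.arbitrary (Conn 1)),
      assembleSeries_count_eq_zero (by norm_num), pow_one]
  have e2 : ∑ C : Conn ((2 : Fin 3) : ℕ), assembleSeries C {t | t.count Finset.univ = 0} =
      (PowerSeries.X * involSeries {t | t.count Finset.univ = 0}) ^ 2 := by
    change ∑ C : Conn 2, assembleSeries C {t | t.count Finset.univ = 0} = _
    rw [Fintype.sum_subsingleton _ (Classical.arbitrary (Conn 2)),
      assembleSeries_count_eq_zero le_rfl]
  rw [e0, e1, e2] at h
  linear_combination h

theorem isRat_involSeries_count_zero : IsRat (involSeries {t | t.count Finset.univ = 0}) := by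
  have h := involSeries_count_zero_eq
  set M := involSeries {t | t.count Finset.univ = 0}
  -- Completing the square in the Motzkin equation: the left side squares to `(1 - x)² - 4x² = 1 -
  -- 2x - 3x²`, and its constant term 1 selects the root.
  have hs : 1 - PowerSeries.X - 2 * PowerSeries.X ^ 2 * M = sqrtSeries := by
    apply sqrtSeries_unique
    · simp
    · linear_combination (-4 * PowerSeries.X ^ 2) * h
  have h2 : IsRat (2 * PowerSeries.X ^ 2) := (isRat_natCast 2).mul (isRat_X.pow 2)
  refine IsRat.of_mul ?_ h2 ?_
  · have h20 : (2 : ℚ⟦X⟧) ≠ 0 := fun h => by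
      have := congrArg PowerSeries.constantCoeff h
      rw [map_ofNat, map_zero] at this
      norm_num at this
    exact mul_ne_zero h20 (pow_ne_zero 2 PowerSeries.X_ne_zero)
  · have : 2 * PowerSeries.X ^ 2 * M = 1 - PowerSeries.X - sqrtSeries := by
      rw [← hs]
      ring
    rw [this]
    exact (isRat_one.sub isRat_X).sub isRat_sqrtSeries

/-! ### Induction over the classes -/

/-- `topStat r` is the largest vector without occurrences, so the induction below any other such
vector never meets it. -/
theorem isRat_capClass_of_univ_eq_zero {r : ℕ} (v : Finset (Fin 4) → Fin (r + 2))
    (hv : v Finset.univ = 0) (hne : v ≠ topStat r) : IsRat (involSeries (capClass r v)) := by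
  induction v using WellFoundedLT.induction with
  | ind v ih =>
    refine isRat_capClass_of_lt (by simp [hv]) hne fun w hw => ih w hw ?_ ?_
    · have := hw.le Finset.univ
      rw [hv] at this
      exact Fin.le_zero_iff.1 this
    · rintro rfl
      exact (hw.trans_le (le_topStat hv)).false

/-- The quadratic equation of this class is avoided: its series is the Motzkin series minus the
series of the other classes without occurrences. -/
theorem isRat_capClass_topStat (r : ℕ) : IsRat (involSeries (capClass r (topStat r))) := by
  have h := involSeries_count_eq_sum (Nat.zero_le r)
  have hmem : topStat r ∈ Finset.univ.filter
      fun v : Finset (Fin 4) → Fin (r + 2) => (v Finset.univ : ℕ) = 0 := by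
    simp [topStat]
  rw [← Finset.add_sum_erase _ _ hmem] at h
  rw [eq_sub_of_add_eq h.symm]
  refine isRat_involSeries_count_zero.sub (IsRat.sum _ fun v hv => ?_)
  obtain ⟨hne, hv⟩ := Finset.mem_erase.1 hv
  exact isRat_capClass_of_univ_eq_zero v (Fin.ext (Finset.mem_filter.1 hv).2) hne

theorem isRat_capClass {r : ℕ} (v : Finset (Fin 4) → Fin (r + 2))
    (hv : (v Finset.univ : ℕ) ≤ r) : IsRat (involSeries (capClass r v)) := by
  induction v using WellFoundedLT.induction with
  | ind v ih =>
    by_cases hne : v = topStat r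
    · rw [hne]
      exact isRat_capClass_topStat r
    · exact isRat_capClass_of_lt hv hne fun w hw =>
        ih w hw ((Fin.le_def.1 (hw.le Finset.univ)).trans hv)

/-! ### Return to permutations and full occurrences -/

theorem card_occurrences {n : ℕ} (π : Equiv.Perm (Fin n)) :
    (occurrences pattern3412 π).card = occCount π Set.univ Finset.univ := by
  have : partialOccurrences π Set.univ Finset.univ
      = (fun p b => some (p b)) '' (occurrences pattern3412 π : Set (Fin 4 → Fin n)) := by
    ext g
    constructor
    · rintro ⟨h1, -, h3⟩
      choose p hp using fun b => Option.isSome_iff_exists.1 ((h1 b).2 (Finset.mem_univ b))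
      refine ⟨p, ?_, funext fun b => (hp b).symm⟩
      simp only [occurrences, Finset.coe_filter, Finset.mem_univ, true_and, Set.mem_ofPred_eq]
      exact ⟨fun a b hab => (h3 a b _ _ (hp a) (hp b)).1.2 hab,
        fun a b => (h3 a b _ _ (hp a) (hp b)).2⟩
    · rintro ⟨p, hp, rfl⟩
      simp only [occurrences, Finset.coe_filter, Finset.mem_univ, true_and,
        Set.mem_ofPred_eq] at hp
      refine ⟨by simp, fun _ _ _ => trivial, fun a b x y hx hy => ?_⟩
      obtain rfl := Option.some.inj hx
      obtain rfl := Option.some.inj hy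
      have hmono : StrictMono p := fun a b hab => hp.1 a b hab
      exact ⟨hmono.lt_iff_lt, hp.2 a b⟩
  rw [occCount, this, Set.ncard_image_of_injective, Set.ncard_coe_finset]
  intro p q h
  funext b
  exact Option.some.inj (congrFun h b)

theorem genFun_eq_involSeries (r : ℕ) :
    genFun r = involSeries {t | t.count Finset.univ = r} := by
  ext n
  rw [genFun, PowerSeries.coeff_mk, involSeries, coeff_sizeSeries, ← Nat.card_eq_finsetCard]
  congr 1
  let u : involutions3412 r n →
      {t : {t : Invol | t.count Finset.univ = r} // t.1.1 = n} := fun π =>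
    have hπ := (Finset.mem_filter.1 π.2).2
    ⟨⟨⟨n, π.1, fun x => by
      have := Equiv.congr_fun hπ.1 (π.1 x)
      simpa using this⟩, (card_occurrences π.1).symm.trans hπ.2⟩, rfl⟩
  refine Nat.card_congr (Equiv.ofBijective u ⟨fun π ρ h => ?_, ?_⟩)
  · have h1 := congrArg (fun t => t.1.1) h
    simp only [u, Sigma.mk.injEq, heq_eq_eq, true_and] at h1
    exact Subtype.ext (DFunLike.coe_injective (congrArg Subtype.val h1))
  · rintro ⟨⟨⟨m, f, hf⟩, ht⟩, hm⟩
    dsimp only at hm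
    subst hm
    refine ⟨⟨hf.toPerm, Finset.mem_filter.2 ⟨Finset.mem_univ _, ?_, ?_⟩⟩, rfl⟩
    · exact (hf.toPerm_symm).symm
    · rw [card_occurrences]
      exact ht

theorem isRat_genFun (r : ℕ) : IsRat (genFun r) := by
  rw [genFun_eq_involSeries, involSeries_count_eq_sum le_rfl]
  exact IsRat.sum _ fun v hv => isRat_capClass v (Finset.mem_filter.1 hv).2.le

end PatternInvolutions

theorem corollary4p1 (r : ℕ) :
    ∃ P Q : MvPolynomial (Fin 2) ℚ,
      (MvPolynomial.aeval ![PowerSeries.X, PatternInvolutions.sqrtSeries] Q : ℚ⟦X⟧) ≠ 0 ∧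
      (PatternInvolutions.genFun r : ℚ⸨X⸩) =
        ((MvPolynomial.aeval ![PowerSeries.X, PatternInvolutions.sqrtSeries] P : ℚ⟦X⟧) : ℚ⸨X⸩) /
        ((MvPolynomial.aeval ![PowerSeries.X, PatternInvolutions.sqrtSeries] Q : ℚ⟦X⟧) : ℚ⸨X⸩) :=
  (PatternInvolutions.isRat_genFun r).exists_eq_div
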